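/- Let $\mathfrak g$ be a finite-dimensional simple complex Lie algebra with a Cartan subalgebra $\mathfrak h$, Weyl group $W$, a base of its root system, $\rho$ half the sum of the positive roots, and $\Lambda^+$ the set of dominant integral weights. Let $(\cdot,\cdot)$ be the inner product on weights induced by the Killing form, multiplied by an arbitrary real constant $c>0$ (so every normalization of the invariant inner product is covered). Let $T(a,b)$ be a torus knot, with $0<a<b$ coprime integers, and let $V_\lambda$ be the finite-dimensional irreducible $\mathfrak g$-module with highest weight $\lambda$ (a dominant integral weight), with set of weights $\Pi_\lambda$ and formal character $ch_\lambda=\sum_{\nu\in\Pi_\lambda}\dim (V_\lambda)_\nu\, e_\nu$. Put $$S_{\lambda,a}=\Big[\bigcup_{\sigma\in W}\big(\sigma(\rho)-\rho+a\Pi_\lambda\big)\Big]\cap\Lambda^+ ,$$ $$f(\mu)=\frac{b}{2a}(\mu,\mu)+\Big(1+\frac ba\Big)(\mu,\rho)-\frac{ab}{2}(\lambda,\lambda)-(1+ab)(\lambda,\rho).$$ Then $a\lambda\in S_{\lambda,a}$, and $f(\mu)<f(a\lambda)$ for every $\mu\in S_{\lambda,a}$ with $\mu\ne a\lambda$; that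 is, $f$ attains its maximum on $S_{\lambda,a}$ uniquely at $\mu=a\lambda$. Moreover, let $\psi_a$ be the $a$-th Adams operation, $\psi_a(e_\nu)=e_{a\nu}$. There is exactly one finitely supported family of integers $m^\mu_{\lambda,a}$, $\mu\in\Lambda^+$, with $\psi_a(ch_\lambda)=\sum_{\mu\in\Lambda^+} m^\mu_{\lambda,a}\,ch_\mu$, and the plethysm multiplicity of $V_{a\lambda}$ satisfies $m^{a\lambda}_{\lambda,a}=1$. -/

import Mathlib

open scoped AddMonoidAlgebra

universe u v

noncomputable section

namespace TorusPlethysm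

variable {L : Type u} [LieRing L] [LieAlgebra ℂ L] [FiniteDimensional ℂ L]
  [LieAlgebra.IsKilling ℂ L] {H : LieSubalgebra ℂ L} [H.IsCartanSubalgebra]

/-- The dominant integral weights with respect to a base `b` of the root system: the linear forms
on the Cartan subalgebra taking natural number values on all simple coroots. -/
def dominantWeights (b : (LieAlgebra.IsKilling.rootSystem H).Base) : Set (Module.Dual ℂ H) :=
  {μ | ∀ i ∈ b.support, ∃ n : ℕ, μ ((LieAlgebra.IsKilling.rootSystem H).coroot i) = n}

open Classical in
/-- `ρ`, half the sum of the positive roots. -/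
def rho (b : (LieAlgebra.IsKilling.rootSystem H).Base) : Module.Dual ℂ H :=
  (1 / 2 : ℂ) • ∑ i : H.root with b.IsPos i, (LieAlgebra.IsKilling.rootSystem H).root i

/-- The inner product on weights induced by the Killing form `κ`, scaled by `c`: it sends `(μ, ν)`
to `c * κ(t_μ, t_ν)`, where `t_μ` in the Cartan subalgebra is defined by `κ(t_μ, h) = μ(h)`.
On the real span of the roots, which contains all integral weights, `κ(t_μ, t_ν)` is real, so that
taking the real part loses nothing there. -/
def weightInner (c : ℝ) (μ ν : Module.Dual ℂ H) : ℝ :=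
  c * (killingForm ℂ L ((LieAlgebra.IsKilling.cartanEquivDual H).symm μ)
    ((LieAlgebra.IsKilling.cartanEquivDual H).symm ν)).re

/-- The maximum degree
`f(μ) = b/(2a) (μ,μ) + (1 + b/a) (μ,ρ) - ab/2 (λ,λ) - (1 + ab) (λ,ρ)`
of the summand indexed by `μ` in the Jones-Rosso formula for the torus knot `T(p, q)`, where `p`
and `q` stand for `a` and `b`, and `lam` for `λ`. -/
def maxDegree (b : (LieAlgebra.IsKilling.rootSystem H).Base) (c : ℝ) (p q : ℕ)
    (lam μ : Module.Dual ℂ H) : ℝ :=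
  (q : ℝ) / (2 * p) * weightInner c μ μ + (1 + (q : ℝ) / p) * weightInner c μ (rho b)
    - (p * q : ℝ) / 2 * weightInner c lam lam - (1 + (p * q : ℝ)) * weightInner c lam (rho b)

section Modules

variable (H) (V : Type*) [AddCommGroup V] [Module ℂ V] [LieRingModule L V] [LieModule ℂ L V]

/-- The set of weights of an `L`-module with respect to `H`. -/
def weights : Set (Module.Dual ℂ H) := {ν | LieModule.weightSpace V (ν : H → ℂ) ≠ ⊥}

set_option linter.unusedSectionVars false in
theorem weights_finite [FiniteDimensional ℂ V] : (weights H V).Finite := by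
  refine Set.Finite.of_finite_image (f := fun ν : Module.Dual ℂ H => (ν : H → ℂ)) ?_
    (fun x _ y _ h => DFunLike.coe_injective h)
  refine (LieModule.finite_genWeightSpace_ne_bot ℂ H V).subset ?_
  rintro _ ⟨ν, hν, rfl⟩
  exact fun h => hν (le_bot_iff.mp (h ▸ LieModule.weightSpace_le_genWeightSpace V _))

/-- The formal character `∑ dim V_ν e_ν` of a finite-dimensional `L`-module, as an element of the
group ring `ℤ[H*]`. -/
def formalCharacter [FiniteDimensional ℂ V] : ℤ[Module.Dual ℂ H] :=
  .ofCoeff <| Finsupp.ofSupportFinite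
    (fun ν => (Module.finrank ℂ (LieModule.weightSpace V (ν : H → ℂ)) : ℤ))
    ((weights_finite H V).subset fun ν hν h => hν (by
      change ((Module.finrank ℂ (LieModule.weightSpace V (ν : H → ℂ)).toSubmodule : ℕ) : ℤ) = 0
      rw [h]; simp))

variable {H}

/-- `V` is an irreducible `L`-module with highest weight `lam`: it is irreducible and has a non-zero
vector of weight `lam` that is annihilated by all positive root spaces. -/
structure IsIrredOfHighestWeight (b : (LieAlgebra.IsKilling.rootSystem H).Base)
    (lam : Module.Dual ℂ H) : Prop where
  irreducible : LieModule.IsIrreducible ℂ L V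
  exists_vector : ∃ v : V, v ≠ 0 ∧ (∀ h : H, ⁅h, v⁆ = lam h • v) ∧
    ∀ i : H.root, b.IsPos i → ∀ x ∈ LieAlgebra.rootSpace H (i : LieModule.Weight ℂ H L),
      ⁅x, v⁆ = 0

/-- The summation set `S_{λ,a} = [⋃_σ (σ(ρ) - ρ + a Π_λ)] ∩ Λ⁺`, for `V = V_λ`. -/
def summationSet (b : (LieAlgebra.IsKilling.rootSystem H).Base) (a : ℕ) :
    Set (Module.Dual ℂ H) :=
  (⋃ σ : (LieAlgebra.IsKilling.rootSystem H).weylGroup,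
    (fun ν => σ • rho b - rho b + a • ν) '' weights H V) ∩ dominantWeights b

end Modules

/-- The `a`-th Adams operation on the group ring `ℤ[H*]`: the ring endomorphism with
`e_μ ↦ e_{aμ}`. -/
def adams (a : ℕ) : ℤ[Module.Dual ℂ H] →+* ℤ[Module.Dual ℂ H] :=
  AddMonoidAlgebra.mapDomainRingHom ℤ (nsmulAddMonoidHom (α := Module.Dual ℂ H) a)

/-- `χ` is the character `ch_μ` of the irreducible finite-dimensional module `V_μ` with highest
weight `μ`. The universe `v` of that module is immaterial, since every finite-dimensional module has
an isomorphic copy in each universe. -/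
def IsIrredCharacter (b : (LieAlgebra.IsKilling.rootSystem H).Base) (μ : Module.Dual ℂ H)
    (χ : ℤ[Module.Dual ℂ H]) : Prop :=
  ∃ (M : Type v) (_ : AddCommGroup M) (_ : Module ℂ M) (_ : LieRingModule L M)
    (_ : LieModule ℂ L M) (_ : FiniteDimensional ℂ M),
    IsIrredOfHighestWeight M b μ ∧ χ = formalCharacter H M

/-- `m` is a system of plethysm multiplicities for `ψ_a(χ)`: an expansion
`ψ_a(χ) = ∑ m_μ ch_μ` in the characters of the irreducible modules `V_μ`, `μ` dominant, with integer
coefficients, finitely many of them non-zero. -/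
def IsPlethysmMultiplicity (b : (LieAlgebra.IsKilling.rootSystem H).Base) (a : ℕ)
    (χ : ℤ[Module.Dual ℂ H]) (m : Module.Dual ℂ H →₀ ℤ) : Prop :=
  (∀ μ ∈ m.support, μ ∈ dominantWeights b) ∧
  ∃ ch : Module.Dual ℂ H → ℤ[Module.Dual ℂ H],
    (∀ μ ∈ m.support, IsIrredCharacter.{u, v} b μ (ch μ)) ∧
    adams a χ = m.sum fun μ k => k • ch μ

end TorusPlethysm

end

/-!
The weights of `V_λ` lie below `λ` and `σρ ≤ ρ` for every `σ` in the Weyl group, where `μ ≤ κ` means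
that `κ - μ` is a nonnegative combination of simple roots. So all elements `μ` of the summation set
lie below `aλ`. On dominant weights, `f` is strictly increasing for this order: with `d = κ - μ`,
`(κ, κ) - (μ, μ) = (d, κ + μ) ≥ 0`, because `κ + μ` is dominant, and `(d, ρ) > 0` if `d ≠ 0`,
because `ρ` is `1` on simple coroots (`maxDegree_lt_maxDegree`).

The expansion of `ψ_a(ch_λ)` is found without constructing `V_μ` for arbitrary dominant `μ`.
In terms of a basis of weight vectors with weights `ν_i`, `ψ_a(ch_λ)` is the power sum
`∑ (e_{ν_i})^a`. By Newton's identity `k h_k = ∑ p_i h_{k-i}`, it is an integer polynomial in the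
complete homogeneous sums of the `e_{ν_i}`, which are the characters of the symmetric powers of
`V_λ`; and products of characters are characters of tensor products. Going through a composition
series, `ψ_a(ch_λ)` is therefore an integer combination of irreducible characters
(`adams_formalCharacter_mem_closure`). Complete reducibility is not needed, only that `H` acts
diagonalizably, which passes from irreducible modules to all modules that occur.

Uniqueness and `m^{aλ} = 1` follow by comparing terms of highest weight, measured by `(·, ρ)`
(`coeff_sum_irredCharacter`): `ch_μ` is `e_μ` plus lower terms and depends on `μ` only
(`IsIrredOfHighestWeight.formalCharacter_eq`), and the highest term of `ψ_a(ch_λ)` is `e_{aλ}`.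
-/

noncomputable section

namespace TorusPlethysm

set_option linter.unusedSectionVars false

open LieAlgebra LieAlgebra.IsKilling Module

variable {L : Type u} [LieRing L] [LieAlgebra ℂ L] [FiniteDimensional ℂ L]
  [LieAlgebra.IsKilling ℂ L] {H : LieSubalgebra ℂ L} [H.IsCartanSubalgebra]

/-! ### Modules spanned by weight vectors -/

section WeightVectors

variable {V : Type*} [AddCommGroup V] [Module ℂ V] [LieRingModule L V] [LieModule ℂ L V]

/-- `v` is a vector of weight `ν` (possibly zero) for the Cartan subalgebra `H`. -/
def HasWeight (ν : Dual ℂ H) (v : V) : Prop := ∀ h : H, ⁅(h : L), v⁆ = ν h • v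

variable (H V) in
/-- The Cartan subalgebra acts diagonalizably on `V`: the weight vectors span `V`. -/
def IsDiagonalizable : Prop :=
  Submodule.span ℂ {v : V | ∃ ν : Dual ℂ H, HasWeight ν v} = ⊤

theorem mem_weightSpace_iff_hasWeight {ν : Dual ℂ H} {v : V} :
    v ∈ LieModule.weightSpace V (ν : H → ℂ) ↔ HasWeight ν v :=
  LieModule.mem_weightSpace _ _

theorem mem_weights_iff {ν : Dual ℂ H} :
    ν ∈ weights H V ↔ ∃ v : V, v ≠ 0 ∧ HasWeight ν v := by
  simp only [weights, Set.mem_ofPred_eq, ne_eq, LieSubmodule.eq_bot_iff, not_forall,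
    mem_weightSpace_iff_hasWeight]
  exact ⟨fun ⟨v, h, h0⟩ => ⟨v, h0, h⟩, fun ⟨v, h0, h⟩ => ⟨v, h, h0⟩⟩

/-- A root vector of root `α` raises weights by `α`. -/
theorem HasWeight.lie {ν : Dual ℂ H} {v : V} (hv : HasWeight ν v)
    {i : H.root} {x : L} (hx : x ∈ rootSpace H (i : LieModule.Weight ℂ H L)) :
    HasWeight ((rootSystem H).root i + ν) ⁅x, v⁆ := by
  intro h
  have h1 : ⁅(h : L), x⁆ = (i : LieModule.Weight ℂ H L) h • x := lie_eq_smul_of_mem_rootSpace hx h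
  rw [leibniz_lie, h1, hv h, smul_lie, lie_smul, ← add_smul]
  rfl

/-- A subspace of `L` containing the Cartan subalgebra and all root spaces is everything. -/
theorem eq_top_of_cartan_le_of_rootSpace_le (S : Submodule ℂ L) (hH : ∀ h : H, (h : L) ∈ S)
    (hS : ∀ i : H.root, ∀ x ∈ rootSpace H (i : LieModule.Weight ℂ H L), x ∈ S) : S = ⊤ := by
  have h := congrArg LieSubmodule.toSubmodule (cartan_sup_iSup_rootSpace_eq_top (K := ℂ) (H := H))
  rw [LieSubmodule.top_toSubmodule] at h
  rw [eq_top_iff, ← h, LieSubmodule.sup_toSubmodule, sup_le_iff]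
  refine ⟨fun x hx => hH ⟨x, by simpa using hx⟩, ?_⟩
  simp only [LieSubmodule.iSup_toSubmodule, iSup_le_iff]
  intro α hα x hx
  exact hS ⟨α, by simpa using hα⟩ x hx

/-- Over a Lie algebra with non-degenerate Killing form, the Cartan subalgebra acts diagonalizably
on irreducible modules: Lie's theorem yields a weight vector, and the span of all weight vectors is
a submodule. -/
theorem isDiagonalizable_of_isIrreducible [FiniteDimensional ℂ V]
    (hV : LieModule.IsIrreducible ℂ L V) : IsDiagonalizable H V := by
  have : Nontrivial V := LieModule.nontrivial_of_isIrreducible ℂ L V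
  let T : Submodule ℂ V := Submodule.span ℂ {v : V | ∃ ν : Dual ℂ H, HasWeight ν v}
  let S : Submodule ℂ L := ⨅ m : T, T.comap ((LieModule.toEnd ℂ L V : L →ₗ[ℂ] End ℂ V).flip m)
  have hSmem (x : L) : x ∈ S ↔ ∀ m ∈ T, ⁅x, m⁆ ∈ T := by
    simp [S]
  have hSspan (x : L) (h : ∀ v : V, (∃ ν : Dual ℂ H, HasWeight ν v) → ⁅x, v⁆ ∈ T) : x ∈ S := by
    rw [hSmem]
    intro m hm
    exact (Submodule.span_le (p := T.comap (LieModule.toEnd ℂ L V x))).2 h hm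
  have hS : S = ⊤ := by
    refine eq_top_of_cartan_le_of_rootSpace_le (H := H) S (fun h => hSspan _ ?_)
      (fun i x hx => hSspan _ ?_)
    · rintro v ⟨ν, hv⟩
      rw [hv h]
      exact T.smul_mem _ (Submodule.subset_span ⟨ν, hv⟩)
    · rintro v ⟨ν, hv⟩
      exact Submodule.subset_span ⟨_, hv.lie hx⟩
  let N : LieSubmodule ℂ L V :=
    { T with lie_mem := fun {x m} hm => (hSmem x).1 (hS ▸ Submodule.mem_top) m hm }
  obtain ⟨χ, hχ⟩ := LieModule.exists_nontrivial_weightSpace_of_isSolvable ℂ H V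
  obtain ⟨⟨v, hv⟩, hv0⟩ := exists_ne (0 : LieModule.weightSpace V (χ : H → ℂ))
  have hvN : v ∈ N := Submodule.subset_span ⟨χ, mem_weightSpace_iff_hasWeight.1 hv⟩
  have hN : N = ⊤ := (IsSimpleOrder.eq_bot_or_eq_top N).resolve_left fun h0 => by
    rw [h0, LieSubmodule.mem_bot] at hvN
    exact hv0 (Subtype.ext hvN)
  exact congrArg LieSubmodule.toSubmodule hN

/-- A diagonalizable module has a basis of weight vectors, which may be chosen in any given spanning
set of weight vectors. -/
theorem exists_weight_basis_of_span_eq_top {V : Type v} [AddCommGroup V] [Module ℂ V]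
    [FiniteDimensional ℂ V] {s : Set V} (hs : Submodule.span ℂ s = ⊤) :
    ∃ (ι : Type v) (_ : Fintype ι) (B : Basis ι ℂ V), ∀ i, B i ∈ s :=
  ⟨_, FiniteDimensional.fintypeBasisIndex (Basis.ofSpan hs.ge), Basis.ofSpan hs.ge,
    fun i => Basis.ofSpan_subset hs.ge ⟨i, rfl⟩⟩

theorem IsDiagonalizable.exists_basis {V : Type v} [AddCommGroup V] [Module ℂ V]
    [LieRingModule L V] [FiniteDimensional ℂ V] (hV : IsDiagonalizable H V) :
    ∃ (ι : Type v) (_ : Fintype ι) (B : Basis ι ℂ V) (ν : ι → Dual ℂ H),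
      ∀ i, HasWeight (ν i) (B i) := by
  obtain ⟨ι, hι, B, hB⟩ := exists_weight_basis_of_span_eq_top hV
  choose ν hν using hB
  exact ⟨ι, hι, B, ν, hν⟩

theorem isDiagonalizable_of_basis {ι : Type*} (B : Basis ι ℂ V) (ν : ι → Dual ℂ H)
    (hB : ∀ i, HasWeight (ν i) (B i)) : IsDiagonalizable H V := by
  rw [IsDiagonalizable, eq_top_iff, ← B.span_eq]
  exact Submodule.span_mono (Set.range_subset_iff.2 fun i => ⟨_, hB i⟩)

theorem HasWeight.repr_eq_zero {ι : Type*} (B : Basis ι ℂ V) (ν : ι → Dual ℂ H)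
    (hB : ∀ i, HasWeight (ν i) (B i)) {χ : Dual ℂ H} {v : V} (hv : HasWeight χ v) {i : ι}
    (hi : ν i ≠ χ) : B.repr v i = 0 := by
  obtain ⟨h, hh⟩ : ∃ h, ν i h ≠ χ h := by
    by_contra! hc
    exact hi (LinearMap.ext hc)
  have key : ∀ w : V, B.repr ⁅(h : L), w⁆ i = ν i h * B.repr w i := by
    intro w
    have : (Finsupp.lapply i ∘ₗ B.repr.toLinearMap) ∘ₗ LieModule.toEnd ℂ L V (h : L)
        = ν i h • (Finsupp.lapply i ∘ₗ B.repr.toLinearMap) := by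
      refine B.ext fun j => ?_
      classical
      simp only [LinearMap.comp_apply, LieModule.toEnd_apply_apply, hB j h, LinearMap.smul_apply,
        LinearEquiv.coe_coe, map_smul, Basis.repr_self, Finsupp.lapply_apply,
        Finsupp.single_apply, smul_eq_mul]
      split_ifs with hj
      · rw [hj]
      · simp
    exact LinearMap.congr_fun this w
  have h1 := key v
  rw [hv h, map_smul, Finsupp.smul_apply, smul_eq_mul] at h1
  have h2 : (ν i h - χ h) * B.repr v i = 0 := by rw [sub_mul, h1, sub_self]
  exact (mul_eq_zero.1 h2).resolve_left (sub_ne_zero.2 hh)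

/-- In terms of a basis of weight vectors, the formal character is the sum of the corresponding
exponentials. -/
theorem formalCharacter_eq_sum [FiniteDimensional ℂ V] {ι : Type*} [Fintype ι] (B : Basis ι ℂ V)
    (ν : ι → Dual ℂ H) (hB : ∀ i, HasWeight (ν i) (B i)) :
    formalCharacter H V = ∑ i, AddMonoidAlgebra.single (ν i) (1 : ℤ) := by
  classical
  ext χ
  have hspan : (LieModule.weightSpace V (χ : H → ℂ)).toSubmodule
      = Submodule.span ℂ (Set.range fun i : {i // ν i = χ} => B i) := by
    apply le_antisymm
    · intro v hv
      have hv : HasWeight χ v := mem_weightSpace_iff_hasWeight.1 hv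
      rw [← B.sum_repr v]
      refine Submodule.sum_mem _ fun i _ => ?_
      by_cases hi : ν i = χ
      · exact Submodule.smul_mem _ _ (Submodule.subset_span ⟨⟨i, hi⟩, rfl⟩)
      · rw [hv.repr_eq_zero B ν hB hi, zero_smul]
        exact Submodule.zero_mem _
    · rw [Submodule.span_le]
      rintro _ ⟨⟨i, rfl⟩, rfl⟩
      exact mem_weightSpace_iff_hasWeight.2 (hB i)
  have hrank : finrank ℂ (LieModule.weightSpace V (χ : H → ℂ)).toSubmodule
      = Fintype.card {i // ν i = χ} := by
    rw [hspan, finrank_span_eq_card]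
    exact B.linearIndependent.comp _ Subtype.val_injective
  change ((finrank ℂ (LieModule.weightSpace V (χ : H → ℂ)).toSubmodule : ℕ) : ℤ) = _
  rw [hrank, AddMonoidAlgebra.coeff_sum, Finsupp.finsetSum_apply, Fintype.card_subtype]
  simp [Finsupp.single_apply]

theorem coeff_formalCharacter_ne_zero_iff [FiniteDimensional ℂ V] {χ : Dual ℂ H} :
    (formalCharacter H V).coeff χ ≠ 0 ↔ χ ∈ weights H V := by
  change ((finrank ℂ (LieModule.weightSpace V (χ : H → ℂ)).toSubmodule : ℕ) : ℤ) ≠ 0 ↔ _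
  rw [Nat.cast_ne_zero, ne_eq, Submodule.finrank_eq_zero, weights, Set.mem_ofPred_eq,
    LieSubmodule.toSubmodule_eq_bot]

/-- A bijective linear map commuting with the action of `L` preserves formal characters. -/
theorem formalCharacter_eq_of_bijective {V : Type*} [AddCommGroup V] [Module ℂ V]
    [LieRingModule L V] [LieModule ℂ L V] [FiniteDimensional ℂ V]
    {W : Type v} [AddCommGroup W] [Module ℂ W] [LieRingModule L W] [LieModule ℂ L W]
    [FiniteDimensional ℂ W] (hW : IsDiagonalizable H W) (f : V →ₗ⁅ℂ,L⁆ W)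
    (hf : Function.Bijective f) : formalCharacter H V = formalCharacter H W := by
  obtain ⟨ι, _, B, ν, hB⟩ := hW.exists_basis
  let e : V ≃ₗ[ℂ] W := LinearEquiv.ofBijective (f : V →ₗ[ℂ] W) hf
  rw [formalCharacter_eq_sum B ν hB, formalCharacter_eq_sum (B.map e.symm) ν]
  intro i h
  have he (w : W) : f (e.symm w) = w := e.apply_symm_apply w
  apply hf.1
  rw [Basis.map_apply, LieModuleHom.map_lie, he, hB i h]
  exact (((f : V →ₗ[ℂ] W).map_smul _ _).trans (congrArg _ (he _))).symm

/-- Formal characters are additive along a submodule and its quotient. -/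
theorem formalCharacter_eq_add_quotient [FiniteDimensional ℂ V] (hV : IsDiagonalizable H V)
    (N : LieSubmodule ℂ L V) (hN : IsDiagonalizable H N) :
    IsDiagonalizable H (V ⧸ N) ∧
      formalCharacter H V = formalCharacter H N + formalCharacter H (V ⧸ N) := by
  have hmk (ν : Dual ℂ H) (v : V) (hv : HasWeight ν v) :
      HasWeight ν (LieSubmodule.Quotient.mk v : V ⧸ N) := by
    intro h
    change LieSubmodule.Quotient.mk (N := N) ⁅(h : L), v⁆ = _
    rw [hv h]
    rfl
  let s : Set (V ⧸ N) :=
    {x | ∃ ν : Dual ℂ H, ∃ v : V, HasWeight ν v ∧ LieSubmodule.Quotient.mk v = x}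
  have hs : Submodule.span ℂ s = ⊤ := by
    have h1 := congrArg (Submodule.map N.toSubmodule.mkQ) hV
    rw [Submodule.map_span, Submodule.map_top, Submodule.range_mkQ] at h1
    rw [eq_top_iff, ← h1]
    apply Submodule.span_mono
    rintro _ ⟨v, ⟨ν, hv⟩, rfl⟩
    exact ⟨ν, v, hv, rfl⟩
  obtain ⟨κ, _, C, hC⟩ := exists_weight_basis_of_span_eq_top hs
  choose μ w hw hwC using hC
  obtain ⟨ι, _, B, ν, hB⟩ := hN.exists_basis
  have hCw (j : κ) : HasWeight (μ j) (C j) := hwC j ▸ hmk _ _ (hw j)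
  refine ⟨isDiagonalizable_of_basis C μ hCw, ?_⟩
  have hli : LinearIndependent ℂ (Sum.elim (fun i => (B i : V)) w) := by
    refine LinearIndependent.sumElim_of_quotient (M' := N.toSubmodule) B.linearIndependent w ?_
    convert! C.linearIndependent using 1
    exact funext hwC
  have hcard : Fintype.card (ι ⊕ κ) = finrank ℂ V := by
    rw [Fintype.card_sum, ← finrank_eq_card_basis B, ← finrank_eq_card_basis C, add_comm]
    exact N.toSubmodule.finrank_quotient_add_finrank
  let D := basisOfLinearIndependentOfCardEqFinrank' _ hli hcard
  rw [formalCharacter_eq_sum B ν hB, formalCharacter_eq_sum C μ hCw,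
    formalCharacter_eq_sum D (Sum.elim ν μ), Fintype.sum_sum_type]
  · rfl
  · rintro (i | j)
    · intro h
      simpa [D] using congrArg (Subtype.val : N → V) (hB i h)
    · simpa [D] using hw j

open scoped TensorProduct in
/-- The formal character of a tensor product is the product of the formal characters. -/
theorem formalCharacter_tensorProduct {W : Type*} [AddCommGroup W] [Module ℂ W]
    [LieRingModule L W] [LieModule ℂ L W] [FiniteDimensional ℂ V] [FiniteDimensional ℂ W]
    (hV : IsDiagonalizable H V) (hW : IsDiagonalizable H W) :
    IsDiagonalizable H (V ⊗[ℂ] W) ∧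
      formalCharacter H (V ⊗[ℂ] W) = formalCharacter H V * formalCharacter H W := by
  obtain ⟨ι, _, B, ν, hB⟩ := hV.exists_basis
  obtain ⟨κ, _, C, μ, hC⟩ := hW.exists_basis
  have key (p : ι × κ) : HasWeight (ν p.1 + μ p.2) (B.tensorProduct C p) := by
    intro h
    rw [Basis.tensorProduct_apply', TensorProduct.LieModule.lie_tmul_right, hB, hC,
      LinearMap.add_apply, add_smul, TensorProduct.tmul_smul, ← TensorProduct.smul_tmul']
  refine ⟨isDiagonalizable_of_basis _ _ key, ?_⟩
  rw [formalCharacter_eq_sum _ _ key, formalCharacter_eq_sum B ν hB, formalCharacter_eq_sum C μ hC,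
    Finset.sum_mul_sum, Fintype.sum_prod_type]
  simp [AddMonoidAlgebra.single_mul_single]

end WeightVectors

/-! ### The positive cone of the root lattice and the invariant inner product -/

section Cone

variable (b : (rootSystem H).Base)

/-- The cone of sums of simple roots with natural number coefficients. -/
def rootCone : AddSubmonoid (Dual ℂ H) :=
  AddSubmonoid.closure ((rootSystem H).root '' b.support)

variable {b}

theorem root_mem_rootCone {i : H.root} (hi : b.IsPos i) : (rootSystem H).root i ∈ rootCone b := by
  refine hi.induction_on_add (p := fun i => (rootSystem H).root i ∈ rootCone b) ?_ ?_
  · exact fun j hj => AddSubmonoid.subset_closure ⟨j, hj, rfl⟩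
  · intro j k l hl hj hk
    rw [hl]
    exact add_mem hj (AddSubmonoid.subset_closure ⟨k, hk, rfl⟩)

theorem neg_root_mem_rootCone {i : H.root} (hi : ¬ b.IsPos i) :
    -(rootSystem H).root i ∈ rootCone b := by
  have h : (rootSystem H).root ((rootSystem H).reflectionPerm i i) = -(rootSystem H).root i := by
    rw [RootPairing.root_reflectionPerm, RootPairing.reflection_apply_self]
  rw [← h]
  exact root_mem_rootCone ((RootPairing.Base.IsPos.neg_iff_not b i).2 hi)

open Classical in
theorem two_smul_rho :
    (2 : ℕ) • rho b = ∑ i : H.root with b.IsPos i, (rootSystem H).root i := by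
  rw [rho, ← Nat.cast_smul_eq_nsmul ℂ, smul_smul]
  norm_num

/-- `ρ` takes the value `1` on simple coroots: the reflection in a simple root permutes the other
positive roots. -/
theorem rho_apply_coroot {i : H.root} (hi : i ∈ b.support) :
    rho b ((rootSystem H).coroot i) = 1 := by
  classical
  have hpos : b.IsPos i := RootPairing.Base.isPos_of_mem_support hi
  have hneg (j : H.root) : (rootSystem H).pairing ((rootSystem H).reflectionPerm i j) i
      = -(rootSystem H).pairing j i := by
    rw [← RootPairing.pairing_reflectionPerm, RootPairing.pairing_reflectionPerm_self_right]
  have hsum : ∑ j ∈ (Finset.univ.filter fun j : H.root => b.IsPos j).erase i,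
      (rootSystem H).pairing j i = 0 := by
    refine Finset.sum_involution (fun j _ => (rootSystem H).reflectionPerm i j) ?_ ?_ ?_ ?_
    · intro j _
      rw [hneg, add_neg_cancel]
    · intro j _ h0 hfix
      have h1 := hneg j
      rw [hfix] at h1
      exact h0 (self_eq_neg.1 h1)
    · intro j hj
      rw [Finset.mem_erase, Finset.mem_filter] at hj ⊢
      refine ⟨fun h => ?_, Finset.mem_univ _, hj.2.2.reflectionPerm hi hj.1⟩
      have h1 : b.IsPos ((rootSystem H).reflectionPerm i i) := by
        have : j = (rootSystem H).reflectionPerm i i := by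
          exact ((rootSystem H).reflectionPerm_self i j).symm.trans (by rw [h])
        exact this ▸ hj.2.2
      exact (RootPairing.Base.IsPos.neg_iff_not b i).1 h1 hpos
    · intro j _
      simp
  have h2 := LinearMap.congr_fun (two_smul_rho (b := b)) ((rootSystem H).coroot i)
  rw [← Finset.add_sum_erase _ _ (Finset.mem_filter.2 ⟨Finset.mem_univ i, hpos⟩),
    LinearMap.add_apply, LinearMap.sum_apply] at h2
  have h3 (j : H.root) : (rootSystem H).root j ((rootSystem H).coroot i)
      = (rootSystem H).pairing j i := rfl
  simp only [h3] at h2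
  rw [hsum, RootPairing.pairing_same, LinearMap.smul_apply] at h2
  simpa using h2

/-- `ρ` is the largest element of its Weyl group orbit. In `2ρ - 2σρ`, the sum of the positive roots
minus that of their images under `σ`, the common terms cancel; what remains are positive roots with
sign `1` and negative roots with sign `-1`. -/
theorem exists_two_smul_rho_eq (σ : (rootSystem H).weylGroup) :
    ∃ d ∈ rootCone b, (2 : ℕ) • rho b = (2 : ℕ) • (σ • rho b) + d := by
  classical
  let Φ : Finset H.root := Finset.univ.filter fun j : H.root => b.IsPos j
  let S : Finset H.root := Φ.map ((rootSystem H).weylGroupToPerm σ).toEmbedding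
  have hσ : (2 : ℕ) • (σ • rho b) = ∑ i ∈ S, (rootSystem H).root i := by
    rw [← smul_comm, two_smul_rho, Finset.smul_sum, Finset.sum_map]
    exact Finset.sum_congr rfl fun i _ => RootPairing.weylGroup_apply_root _ σ i
  refine ⟨∑ i ∈ Φ \ S, (rootSystem H).root i + ∑ i ∈ S \ Φ, -(rootSystem H).root i,
    add_mem (sum_mem fun i hi => ?_) (sum_mem fun i hi => ?_), ?_⟩
  · exact root_mem_rootCone (Finset.mem_filter.1 (Finset.mem_sdiff.1 hi).1).2
  · exact neg_root_mem_rootCone fun h =>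
      (Finset.mem_sdiff.1 hi).2 (Finset.mem_filter.2 ⟨Finset.mem_univ i, h⟩)
  · rw [two_smul_rho, hσ, Finset.sum_neg_distrib]
    have h1 := Finset.sum_inter_add_sum_sdiff Φ S (rootSystem H).root
    have h2 := Finset.sum_inter_add_sum_sdiff S Φ (rootSystem H).root
    rw [Finset.inter_comm] at h2
    change ∑ i ∈ Φ, _ = _
    rw [← h1, ← h2]
    abel

theorem weightInner_comm (c : ℝ) (μ ν : Dual ℂ H) : weightInner c μ ν = weightInner c ν μ := by
  rw [weightInner, weightInner, LieModule.traceForm_comm]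

theorem weightInner_add_left (c : ℝ) (μ μ' ν : Dual ℂ H) :
    weightInner c (μ + μ') ν = weightInner c μ ν + weightInner c μ' ν := by
  rw [weightInner, weightInner, weightInner, ← mul_add, ← Complex.add_re, ← LinearMap.add_apply,
    ← map_add, map_add (cartanEquivDual H).symm]
  rfl

theorem weightInner_add_right (c : ℝ) (μ ν ν' : Dual ℂ H) :
    weightInner c μ (ν + ν') = weightInner c μ ν + weightInner c μ ν' := by
  rw [weightInner_comm, weightInner_add_left, weightInner_comm c ν, weightInner_comm c ν']

/-- Pairing with a root under the inner product is a positive multiple of evaluation at the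
coroot, as the Killing form is positive on coroots. -/
theorem exists_weightInner_root_eq (i : H.root) : ∃ r : ℝ, 0 < r ∧ ∀ (c : ℝ) (ν : Dual ℂ H),
    weightInner c ((rootSystem H).root i) ν = c * (r * (ν ((rootSystem H).coroot i)).re) := by
  let α : LieModule.Weight ℂ H L := i
  let t : H := (cartanEquivDual H).symm α.toLinear
  have hform : ((killingForm ℂ L).restrict H) (coroot α) (coroot α)
      = ((∑ j : H.root, ((rootSystem H).pairingIn ℤ j i) ^ 2 : ℤ) : ℂ) := by
    rw [← corootForm_rootSystem_eq_killing, ← rootSystem_coroot_apply,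
      RootPairing.corootForm_apply_apply, Int.cast_sum]
    refine Finset.sum_congr rfl fun j _ => ?_
    rw [sq, Int.cast_mul]
    have h := (rootSystem H).algebraMap_pairingIn ℤ j i
    rw [algebraMap_int_eq, eq_intCast] at h
    rw [h]
    rfl
  have hpos : 0 < ∑ j : H.root, ((rootSystem H).pairingIn ℤ j i) ^ 2 := by
    refine Finset.sum_pos' (fun j _ => sq_nonneg _) ⟨i, Finset.mem_univ i, ?_⟩
    simp
  generalize ∑ j : H.root, ((rootSystem H).pairingIn ℤ j i) ^ 2 = K at hform hpos
  have hα : α.IsNonZero := H.isNonZero_coe_root i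
  have ht : α t ≠ 0 := root_apply_cartanEquivDual_symm_ne_zero hα
  have hK : (K : ℂ) * α t = 4 := by
    have h1 : ((killingForm ℂ L).restrict H) (coroot α) (coroot α)
        = LieModule.traceForm ℂ H L (coroot α) (coroot α) := rfl
    rw [h1, traceForm_coroot, root_apply_coroot hα] at hform
    rw [← hform]
    change (2 • (α t)⁻¹ • (2 : ℂ)) * α t = 4
    simp only [smul_eq_mul, nsmul_eq_mul]
    field_simp
    norm_num
  have hK0 : (K : ℂ) ≠ 0 := fun h => by simp [h] at hK
  refine ⟨2 / K, by positivity, fun c ν => ?_⟩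
  have hval : killingForm ℂ L ((cartanEquivDual H).symm ν) t = ν t :=
    LinearMap.congr_fun ((cartanEquivDual H).apply_symm_apply ν) t
  have hco : (rootSystem H).coroot i = 2 • (α t)⁻¹ • t := rfl
  -- With `K = κ(h, h)` for the coroot `h`, one has `t = (2 / K) h`.
  have ht2 : t = ((2 / K : ℝ) : ℂ) • (rootSystem H).coroot i := by
    rw [hco, ← Nat.cast_smul_eq_nsmul ℂ, smul_smul, smul_smul]
    have : ((2 / K : ℝ) : ℂ) * (((2 : ℕ) : ℂ) * (α t)⁻¹) = 1 := by
      push_cast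
      field_simp
      rw [hK]
      norm_num
    rw [mul_assoc, this, one_smul]
  rw [weightInner_comm, weightInner]
  change c * (killingForm ℂ L ((cartanEquivDual H).symm ν) t).re = _
  rw [hval]
  conv_lhs => rw [ht2]
  rw [map_smul, smul_eq_mul, Complex.re_ofReal_mul]

theorem weightInner_nonneg {c : ℝ} (hc : 0 < c) {d : Dual ℂ H} (hd : d ∈ rootCone b) {ξ : Dual ℂ H}
    (hξ : ∀ i ∈ b.support, 0 ≤ (ξ ((rootSystem H).coroot i)).re) : 0 ≤ weightInner c d ξ := by
  induction hd using AddSubmonoid.closure_induction with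
  | mem _ h =>
    obtain ⟨i, hi, rfl⟩ := h
    obtain ⟨r, hr, h⟩ := exists_weightInner_root_eq i
    rw [h]
    have := hξ i hi
    positivity
  | zero => simp [weightInner]
  | add x y _ _ hx hy => rw [weightInner_add_left]; exact add_nonneg hx hy

theorem weightInner_rho_pos {c : ℝ} (hc : 0 < c) {d : Dual ℂ H} (hd : d ∈ rootCone b)
    (h0 : d ≠ 0) : 0 < weightInner c d (rho b) := by
  suffices d = 0 ∨ 0 < weightInner c d (rho b) from this.resolve_left h0
  clear h0
  induction hd using AddSubmonoid.closure_induction with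
  | mem _ h =>
    obtain ⟨i, hi, rfl⟩ := h
    obtain ⟨r, hr, h⟩ := exists_weightInner_root_eq i
    rw [h, rho_apply_coroot hi, Complex.one_re]
    right
    positivity
  | zero => exact Or.inl rfl
  | add x y _ _ hx hy =>
    rcases hx with rfl | hx
    · simpa using hy
    rcases hy with rfl | hy
    · simpa using Or.inr hx
    rw [weightInner_add_left]
    exact Or.inr (add_pos hx hy)

theorem dominantWeights_apply_nonneg {μ : Dual ℂ H} (hμ : μ ∈ dominantWeights b) :
    ∀ i ∈ b.support, 0 ≤ (μ ((rootSystem H).coroot i)).re := by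
  intro i hi
  obtain ⟨n, hn⟩ := hμ i hi
  rw [hn, Complex.natCast_re]
  exact n.cast_nonneg

/-- On dominant weights, `maxDegree` is strictly increasing for the order given by the cone of
positive roots: for `d = 2(κ - μ)` in the cone, `(κ, κ) - (μ, μ) = (d, κ + μ) / 2 ≥ 0` and
`(κ - μ, ρ) = (d, ρ) / 2 > 0`. -/
theorem maxDegree_lt_maxDegree {c : ℝ} (hc : 0 < c) {p : ℕ} (hp : 0 < p) (q : ℕ) (lam : Dual ℂ H)
    {μ κ d : Dual ℂ H} (hμ : μ ∈ dominantWeights b) (hκ : κ ∈ dominantWeights b)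
    (hd : d ∈ rootCone b) (h : (2 : ℕ) • κ = (2 : ℕ) • μ + d) (hne : μ ≠ κ) :
    maxDegree b c p q lam μ < maxDegree b c p q lam κ := by
  have hd0 : d ≠ 0 := by
    rintro rfl
    have : IsAddTorsionFree (Dual ℂ H) := .of_isTorsionFree ℂ _
    rw [add_zero] at h
    exact hne (nsmul_right_injective two_ne_zero h).symm
  have h1 : 0 < weightInner c d (rho b) := weightInner_rho_pos hc hd hd0
  have h2 : 0 ≤ weightInner c d (κ + μ) := by
    refine weightInner_nonneg hc hd fun i hi => ?_
    rw [LinearMap.add_apply, Complex.add_re]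
    exact add_nonneg (dominantWeights_apply_nonneg hκ i hi) (dominantWeights_apply_nonneg hμ i hi)
  have h3 (ξ : Dual ℂ H) :
      weightInner c κ ξ + weightInner c κ ξ = weightInner c μ ξ + weightInner c μ ξ
        + weightInner c d ξ := by
    rw [← weightInner_add_left, ← weightInner_add_left, ← weightInner_add_left, ← two_nsmul, h,
      two_nsmul]
  have h4 := h3 (rho b)
  have h5 := h3 (κ + μ)
  simp only [weightInner_add_right _ _ κ μ] at h5 h2
  rw [weightInner_comm c μ κ] at h5
  have hA : weightInner c μ μ ≤ weightInner c κ κ := by linarith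
  have hB : weightInner c μ (rho b) < weightInner c κ (rho b) := by linarith
  have hC : (q : ℝ) / (2 * p) * weightInner c μ μ ≤ (q : ℝ) / (2 * p) * weightInner c κ κ :=
    mul_le_mul_of_nonneg_left hA (by positivity)
  have hD : (1 + (q : ℝ) / p) * weightInner c μ (rho b)
      < (1 + (q : ℝ) / p) * weightInner c κ (rho b) :=
    mul_lt_mul_of_pos_left hB (by positivity)
  unfold maxDegree
  linarith

end Cone

/-! ### Highest weight modules -/

section HighestWeight

variable {b : (rootSystem H).Base}

theorem root_ne_zero (i : H.root) : (rootSystem H).root i ≠ 0 := (rootSystem H).ne_zero i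

/-- The cone of the positive roots is pointed. -/
theorem add_ne_zero_of_mem_rootCone {d e : Dual ℂ H} (hd : d ∈ rootCone b) (he : e ∈ rootCone b)
    (h0 : e ≠ 0) : d + e ≠ 0 := by
  intro h
  have h1 := weightInner_rho_pos one_pos he h0
  by_cases hd0 : d = 0
  · exact h0 (by rwa [hd0, zero_add] at h)
  have h2 := weightInner_rho_pos one_pos hd hd0
  have h3 : weightInner 1 d (rho b) + weightInner 1 e (rho b) = 0 := by
    rw [← weightInner_add_left, h]
    simp [weightInner]
  linarith

section Generated

variable {V : Type*} [AddCommGroup V] [Module ℂ V] [LieRingModule L V] [LieModule ℂ L V]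

variable (b) in
/-- `v` is annihilated by all positive root spaces and has weight `μ`. In contrast to the usual
notion of a highest weight vector, `v = 0` is allowed. -/
structure IsHighestWeightVector (μ : Dual ℂ H) (v : V) : Prop where
  hasWeight : HasWeight μ v
  lie_eq_zero : ∀ i : H.root, b.IsPos i → ∀ x ∈ rootSpace H (i : LieModule.Weight ℂ H L), ⁅x, v⁆ = 0

variable (b) in
/-- A subspace stable under all negative root spaces. -/
def IsNegStable (S : Submodule ℂ V) : Prop :=
  ∀ i : H.root, ¬ b.IsPos i → ∀ x ∈ rootSpace H (i : LieModule.Weight ℂ H L), ∀ m ∈ S, ⁅x, m⁆ ∈ S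

/-- The submodule generated by a highest weight vector `v` is already generated by `v` under the
negative root spaces. For the smallest subspace `T` containing `v` and stable under these, the set
of the `t ∈ T` with `L t ⊆ T` has the same two properties, hence is all of `T`. -/
theorem IsHighestWeightVector.exists_lieSubmodule {μ : Dual ℂ H} {v : V}
    (hv : IsHighestWeightVector b μ v) :
    ∃ N : LieSubmodule ℂ L V, v ∈ N ∧
      ∀ S : Submodule ℂ V, v ∈ S → IsNegStable b S → N.toSubmodule ≤ S := by
  let T : Submodule ℂ V := sInf {S | v ∈ S ∧ IsNegStable b S}
  have hTle (S : Submodule ℂ V) (h1 : v ∈ S) (h2 : IsNegStable b S) : T ≤ S := sInf_le ⟨h1, h2⟩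
  have hvT : v ∈ T := Submodule.mem_sInf.2 fun S hS => hS.1
  have hT : IsNegStable b T := fun i hi x hx m hm =>
    Submodule.mem_sInf.2 fun S hS => hS.2 i hi x hx m (hTle S hS.1 hS.2 hm)
  let T' : Submodule ℂ V :=
    { carrier := {t | t ∈ T ∧ ∀ z : L, ⁅z, t⁆ ∈ T}
      add_mem' := fun {s t} hs ht =>
        ⟨T.add_mem hs.1 ht.1, fun z => by rw [lie_add]; exact T.add_mem (hs.2 z) (ht.2 z)⟩
      zero_mem' := ⟨T.zero_mem, fun z => by rw [lie_zero]; exact T.zero_mem⟩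
      smul_mem' := fun c {t} ht =>
        ⟨T.smul_mem c ht.1, fun z => by rw [lie_smul]; exact T.smul_mem c (ht.2 z)⟩ }
  have hvT' : v ∈ T' := by
    refine ⟨hvT, fun z => ?_⟩
    let S : Submodule ℂ L := T.comap ((LieModule.toEnd ℂ L V : L →ₗ[ℂ] End ℂ V).flip v)
    have hS : S = ⊤ := by
      refine eq_top_of_cartan_le_of_rootSpace_le (H := H) S (fun h => ?_) (fun i x hx => ?_)
      · change ⁅(h : L), v⁆ ∈ T
        rw [hv.hasWeight h]
        exact T.smul_mem _ hvT
      · change ⁅x, v⁆ ∈ T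
        by_cases hi : b.IsPos i
        · rw [hv.lie_eq_zero i hi x hx]
          exact T.zero_mem
        · exact hT i hi x hx v hvT
    have hz : z ∈ S := hS ▸ Submodule.mem_top
    exact hz
  have hT' : T ≤ T' := by
    refine hTle T' hvT' fun i hi x hx m hm => ⟨hT i hi x hx m hm.1, fun z => ?_⟩
    rw [leibniz_lie]
    exact T.add_mem (hm.2 _) (hT i hi x hx _ (hm.2 z))
  exact ⟨{ T with lie_mem := fun {z m} hm => (hT' hm).2 z }, hvT, hTle⟩

variable (b) in
/-- A basis of weight vectors whose weights are all strictly below `μ`, except for the basis vector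
with index `i₀`, which has weight `μ`. -/
structure IsHighestWeightBasis (μ : Dual ℂ H) {ι : Type*} (B : Basis ι ℂ V) (ν : ι → Dual ℂ H)
    (i₀ : ι) : Prop where
  hasWeight : ∀ i, HasWeight (ν i) (B i)
  weight_eq : ν i₀ = μ
  weight_lt : ∀ i ≠ i₀, ∃ d ∈ rootCone b, d ≠ 0 ∧ μ = ν i + d

theorem IsHighestWeightBasis.exists_eq_add {μ : Dual ℂ H} {ι : Type*} {B : Basis ι ℂ V}
    {ν : ι → Dual ℂ H} {i₀ : ι} (h : IsHighestWeightBasis b μ B ν i₀) (i : ι) :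
    ∃ d ∈ rootCone b, μ = ν i + d := by
  by_cases hi : i = i₀
  · exact ⟨0, zero_mem _, by rw [hi, h.weight_eq, add_zero]⟩
  · obtain ⟨d, hd, -, hμ⟩ := h.weight_lt i hi
    exact ⟨d, hd, hμ⟩

/-- The coordinate of the highest weight vector vanishes on the image of negative root vectors. -/
theorem IsHighestWeightBasis.repr_lie_eq_zero {μ : Dual ℂ H} {ι : Type*} {B : Basis ι ℂ V}
    {ν : ι → Dual ℂ H} {i₀ : ι} (h : IsHighestWeightBasis b μ B ν i₀) {i : H.root}
    (hi : ¬ b.IsPos i) {x : L} (hx : x ∈ rootSpace H (i : LieModule.Weight ℂ H L)) (m : V) :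
    B.repr ⁅x, m⁆ i₀ = 0 := by
  have : (Finsupp.lapply i₀ ∘ₗ B.repr.toLinearMap) ∘ₗ LieModule.toEnd ℂ L V x = 0 := by
    refine B.ext fun j => ?_
    refine ((h.hasWeight j).lie hx).repr_eq_zero B ν h.hasWeight ?_
    obtain ⟨d, hd, hμ⟩ := h.exists_eq_add j
    rw [h.weight_eq, hμ]
    intro h0
    refine add_ne_zero_of_mem_rootCone hd (neg_root_mem_rootCone hi)
      (neg_ne_zero.2 (root_ne_zero i)) ?_
    rw [add_left_cancel (h0.trans (add_comm _ _)), add_neg_cancel]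
  exact LinearMap.congr_fun this m

/-- In an irreducible module, a highest weight vector is part of a basis of weight vectors whose
other members have strictly smaller weights. -/
theorem exists_isHighestWeightBasis {V : Type v} [AddCommGroup V] [Module ℂ V] [LieRingModule L V]
    [LieModule ℂ L V] [FiniteDimensional ℂ V] (hV : LieModule.IsIrreducible ℂ L V) {μ : Dual ℂ H}
    {v : V} (hv0 : v ≠ 0) (hv : IsHighestWeightVector b μ v) :
    ∃ (ι : Type v) (_ : Fintype ι) (B : Basis ι ℂ V) (ν : ι → Dual ℂ H) (i₀ : ι),
      IsHighestWeightBasis b μ B ν i₀ ∧ B i₀ = v := by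
  obtain ⟨N, hvN, hN⟩ := hv.exists_lieSubmodule
  have hNtop : N = ⊤ := (IsSimpleOrder.eq_bot_or_eq_top N).resolve_left fun h0 => by
    rw [h0, LieSubmodule.mem_bot] at hvN
    exact hv0 hvN
  -- The span of `s` is stable under the negative root spaces, hence everything.
  let s : Set V := {m | m = v ∨ ∃ ν : Dual ℂ H, HasWeight ν m ∧ ∃ d ∈ rootCone b, d ≠ 0 ∧ μ = ν + d}
  have hs : Submodule.span ℂ s = ⊤ := by
    rw [eq_top_iff, ← LieSubmodule.top_toSubmodule (R := ℂ) (L := L), ← hNtop]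
    refine hN _ (Submodule.subset_span (Or.inl rfl)) fun i hi x hx m hm => ?_
    refine (Submodule.span_le (p := (Submodule.span ℂ s).comap (LieModule.toEnd ℂ L V x))).2 ?_ hm
    rintro m (rfl | ⟨ν, hm, d, hd, -, hμ⟩)
    · refine Submodule.subset_span (Or.inr ⟨_, hv.hasWeight.lie hx, _, neg_root_mem_rootCone hi,
        neg_ne_zero.2 (root_ne_zero i), ?_⟩)
      abel
    · refine Submodule.subset_span (Or.inr ⟨_, hm.lie hx, _,
        add_mem hd (neg_root_mem_rootCone hi), add_ne_zero_of_mem_rootCone hd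
          (neg_root_mem_rootCone hi) (neg_ne_zero.2 (root_ne_zero i)), ?_⟩)
      rw [hμ]
      abel
  -- Of the vectors in `s`, only `v` has weight `μ`, so any basis chosen in `s` contains `v`.
  obtain ⟨ι, hι, B, hB⟩ := exists_weight_basis_of_span_eq_top hs
  have hν (i : ι) : ∃ ν : Dual ℂ H, HasWeight ν (B i) ∧
      (B i = v ∧ ν = μ ∨ ∃ d ∈ rootCone b, d ≠ 0 ∧ μ = ν + d) := by
    rcases hB i with h | ⟨ν, h, hd⟩
    · exact ⟨μ, h ▸ hv.hasWeight, Or.inl ⟨h, rfl⟩⟩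
    · exact ⟨ν, h, Or.inr hd⟩
  choose ν hBν hν using hν
  obtain ⟨i₀, hi₀⟩ : ∃ i, B.repr v i ≠ 0 := by
    by_contra! h
    exact hv0 (B.repr.map_eq_zero_iff.1 (Finsupp.ext h))
  have hνi₀ : ν i₀ = μ := by
    by_contra h
    exact hi₀ (hv.hasWeight.repr_eq_zero B ν hBν h)
  have hBi₀ : B i₀ = v := by
    rcases hν i₀ with h | ⟨d, -, hd0, h⟩
    · exact h.1
    · rw [hνi₀] at h
      exact absurd (left_eq_add.1 h) hd0
  refine ⟨ι, hι, B, ν, i₀, ⟨hBν, hνi₀, fun i hi => ?_⟩, hBi₀⟩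
  exact (hν i).resolve_left fun h => hi (B.injective (h.1.trans hBi₀.symm))

end Generated

section Irreducible

variable {V : Type v} [AddCommGroup V] [Module ℂ V] [LieRingModule L V] [LieModule ℂ L V]
  [FiniteDimensional ℂ V] {μ : Dual ℂ H}

theorem IsIrredOfHighestWeight.exists_isHighestWeightVector (hV : IsIrredOfHighestWeight V b μ) :
    ∃ v : V, v ≠ 0 ∧ IsHighestWeightVector b μ v := by
  obtain ⟨v, h0, h1, h2⟩ := hV.exists_vector
  exact ⟨v, h0, h1, h2⟩

/-- All weights of `V_μ` lie below `μ`. -/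
theorem IsIrredOfHighestWeight.exists_eq_add (hV : IsIrredOfHighestWeight V b μ) {χ : Dual ℂ H}
    (hχ : (formalCharacter H V).coeff χ ≠ 0) : ∃ d ∈ rootCone b, μ = χ + d := by
  obtain ⟨v, h0, hv⟩ := hV.exists_isHighestWeightVector
  obtain ⟨ι, _, B, ν, i₀, hB, -⟩ := exists_isHighestWeightBasis hV.irreducible h0 hv
  rw [formalCharacter_eq_sum B ν hB.hasWeight, AddMonoidAlgebra.coeff_sum,
    Finsupp.finsetSum_apply] at hχ
  obtain ⟨i, -, hi⟩ := Finset.exists_ne_zero_of_sum_ne_zero hχ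
  obtain rfl : ν i = χ := by
    by_contra h
    exact hi (by simp [h])
  exact hB.exists_eq_add i

theorem IsIrredOfHighestWeight.coeff_formalCharacter_self (hV : IsIrredOfHighestWeight V b μ) :
    (formalCharacter H V).coeff μ = 1 := by
  obtain ⟨v, h0, hv⟩ := hV.exists_isHighestWeightVector
  obtain ⟨ι, _, B, ν, i₀, hB, -⟩ := exists_isHighestWeightBasis hV.irreducible h0 hv
  rw [formalCharacter_eq_sum B ν hB.hasWeight, AddMonoidAlgebra.coeff_sum,
    Finsupp.finsetSum_apply, Finset.sum_eq_single i₀]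
  · simp [hB.weight_eq]
  · intro i _ hi
    obtain ⟨d, -, hd0, h⟩ := hB.weight_lt i hi
    have : ν i ≠ μ := fun h' => hd0 (left_eq_add.1 (h'.trans h))
    simp [this]
  · simp

/-- The highest weight of a finite-dimensional module is dominant, by the representation theory of
`sl₂`. -/
theorem IsIrredOfHighestWeight.mem_dominantWeights (hV : IsIrredOfHighestWeight V b μ) :
    μ ∈ dominantWeights b := by
  obtain ⟨v, h0, hv⟩ := hV.exists_isHighestWeightVector
  intro i hi
  have hi0 : (i : LieModule.Weight ℂ H L).IsNonZero := H.isNonZero_coe_root i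
  obtain ⟨h, e, f, ht, he, hf⟩ := exists_isSl2Triple_of_weight_isNonZero hi0
  obtain rfl := ht.h_eq_coroot hi0 he hf
  have P : ht.HasPrimitiveVectorWith v (μ (coroot (i : LieModule.Weight ℂ H L))) :=
    ⟨h0, hv.hasWeight _, hv.lie_eq_zero i (RootPairing.Base.isPos_of_mem_support hi) e he⟩
  exact P.exists_nat

variable (b) in
/-- A finite-dimensional irreducible module has a highest weight: any weight `ν` for which `(ν, ρ)`
is largest. -/
theorem exists_isIrredOfHighestWeight (hV : LieModule.IsIrreducible ℂ L V) :
    ∃ μ : Dual ℂ H, IsIrredOfHighestWeight V b μ := by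
  have : Nontrivial V := LieModule.nontrivial_of_isIrreducible ℂ L V
  have hne : (weights H V).Nonempty := by
    obtain ⟨ι, _, B, ν, hB⟩ := (isDiagonalizable_of_isIrreducible (H := H) hV).exists_basis
    obtain ⟨i⟩ := B.index_nonempty
    exact ⟨ν i, mem_weights_iff.2 ⟨B i, B.ne_zero i, hB i⟩⟩
  obtain ⟨μ, hμ, hmax⟩ := (weights_finite H V).exists_maximalFor
    (fun ν => weightInner 1 ν (rho b)) _ hne
  obtain ⟨v, h0, hv⟩ := mem_weights_iff.1 hμ
  refine ⟨μ, hV, v, h0, hv, fun i hi x hx => ?_⟩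
  by_contra hne
  have h1 : (rootSystem H).root i + μ ∈ weights H V := mem_weights_iff.2 ⟨_, hne, hv.lie hx⟩
  have h2 := weightInner_rho_pos one_pos (root_mem_rootCone hi) (root_ne_zero i)
  have h3 := hmax h1
  simp only [weightInner_add_left] at h3
  linarith [h3 (by linarith)]

end Irreducible

section Product

variable {V W : Type*} [AddCommGroup V] [Module ℂ V] [LieRingModule L V] [LieModule ℂ L V]
  [AddCommGroup W] [Module ℂ W] [LieRingModule L W] [LieModule ℂ L W]

/-- The componentwise action on a product of Lie modules. -/
instance prodLieRingModule : LieRingModule L (V × W) where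
  bracket x m := (⁅x, m.1⁆, ⁅x, m.2⁆)
  add_lie x y m := Prod.ext (add_lie x y m.1) (add_lie x y m.2)
  lie_add x m n := Prod.ext (lie_add x m.1 n.1) (lie_add x m.2 n.2)
  leibniz_lie x y m := Prod.ext (leibniz_lie x y m.1) (leibniz_lie x y m.2)

instance prodLieModule : LieModule ℂ L (V × W) where
  smul_lie c x m := Prod.ext (smul_lie c x m.1) (smul_lie c x m.2)
  lie_smul c x m := Prod.ext (lie_smul c x m.1) (lie_smul c x m.2)

/-- For homomorphisms `f` and `g` from a module `U` to irreducible modules with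
`ker f ∩ ker g = 0`, the kernel of `f` is zero or mapped by `g` onto the whole codomain. If `g`
omits a value `w` on this kernel, then `f` is injective. -/
theorem bijective_of_ker_inf_ker {U : Type*} [AddCommGroup U] [Module ℂ U] [LieRingModule L U]
    [LieModule ℂ L U] (hV : LieModule.IsIrreducible ℂ L V) (hW : LieModule.IsIrreducible ℂ L W)
    (f : U →ₗ⁅ℂ,L⁆ V) (g : U →ₗ⁅ℂ,L⁆ W) (hfg : ∀ u, f u = 0 → g u = 0 → u = 0) {u : U}
    (hu : f u ≠ 0) {w : W} (hw : ∀ u, f u = 0 → g u ≠ w) : Function.Bijective f := by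
  constructor
  · refine (injective_iff_map_eq_zero f).2 fun x hx => hfg x hx ?_
    have hbot : f.ker.map g = ⊥ := (IsSimpleOrder.eq_bot_or_eq_top _).resolve_right fun h => by
      have : w ∈ f.ker.map g := h ▸ LieSubmodule.mem_top w
      obtain ⟨y, hy, hyw⟩ := (LieSubmodule.mem_map w).1 this
      exact hw y hy hyw
    have : g x ∈ f.ker.map g := LieSubmodule.mem_map_of_mem hx
    rwa [hbot, LieSubmodule.mem_bot] at this
  · rw [← LieModuleHom.range_eq_top]
    refine (IsSimpleOrder.eq_bot_or_eq_top f.range).resolve_left fun h => hu ?_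
    have : f u ∈ f.range := ⟨u, rfl⟩
    rwa [h, LieSubmodule.mem_bot] at this

end Product

/-- The character of an irreducible module is determined by its highest weight: for highest weight
vectors `v` and `w` of two such modules, the submodule of the product generated by `(v, w)` projects
isomorphically to both factors. It contains neither `(0, w)` nor `(v, 0)`, since the coordinates of
`v` and `w` agree on all of its elements. -/
theorem IsIrredOfHighestWeight.formalCharacter_eq {μ : Dual ℂ H}
    {V : Type*} [AddCommGroup V] [Module ℂ V] [LieRingModule L V] [LieModule ℂ L V]
    [FiniteDimensional ℂ V] {W : Type*} [AddCommGroup W] [Module ℂ W] [LieRingModule L W]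
    [LieModule ℂ L W] [FiniteDimensional ℂ W] (hV : IsIrredOfHighestWeight V b μ)
    (hW : IsIrredOfHighestWeight W b μ) : formalCharacter H V = formalCharacter H W := by
  obtain ⟨v, hv0, hv⟩ := hV.exists_isHighestWeightVector
  obtain ⟨w, hw0, hw⟩ := hW.exists_isHighestWeightVector
  obtain ⟨ι, _, B, ν, i, hB, rfl⟩ := exists_isHighestWeightBasis hV.irreducible hv0 hv
  obtain ⟨κ, _, C, ξ, j, hC, rfl⟩ := exists_isHighestWeightBasis hW.irreducible hw0 hw
  have hvw : IsHighestWeightVector b μ (B i, C j) :=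
    ⟨fun h => Prod.ext (hv.hasWeight h) (hw.hasWeight h),
      fun k hk x hx => Prod.ext (hv.lie_eq_zero k hk x hx) (hw.lie_eq_zero k hk x hx)⟩
  obtain ⟨N, hmem, hN⟩ := hvw.exists_lieSubmodule
  let S : Submodule ℂ (V × W) := LinearMap.eqLocus
    (B.coord i ∘ₗ LinearMap.fst ℂ V W) (C.coord j ∘ₗ LinearMap.snd ℂ V W)
  have hNS : ∀ m ∈ N, B.repr m.1 i = C.repr m.2 j := by
    refine hN S ?_ fun k hk x hx m _ => ?_
    · change B.repr (B i) i = C.repr (C j) j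
      simp
    · exact (hB.repr_lie_eq_zero hk hx m.1).trans (hC.repr_lie_eq_zero hk hx m.2).symm
  let f : N →ₗ⁅ℂ,L⁆ V :=
    { (LinearMap.fst ℂ V W).comp N.toSubmodule.subtype with map_lie' := rfl }
  let g : N →ₗ⁅ℂ,L⁆ W :=
    { (LinearMap.snd ℂ V W).comp N.toSubmodule.subtype with map_lie' := rfl }
  have hf : Function.Bijective f := by
    refine bijective_of_ker_inf_ker hV.irreducible hW.irreducible f g
      (fun u h1 h2 => Subtype.ext (Prod.ext h1 h2)) (u := ⟨_, hmem⟩) hv0 (w := C j) ?_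
    rintro ⟨⟨x, y⟩, hxy⟩ (rfl : x = 0) (rfl : y = C j)
    simpa using hNS _ hxy
  have hg : Function.Bijective g := by
    refine bijective_of_ker_inf_ker hW.irreducible hV.irreducible g f
      (fun u h1 h2 => Subtype.ext (Prod.ext h2 h1)) (u := ⟨_, hmem⟩) hw0 (w := B i) ?_
    rintro ⟨⟨x, y⟩, hxy⟩ (rfl : y = 0) (rfl : x = B i)
    simpa using hNS _ hxy
  rw [← formalCharacter_eq_of_bijective (isDiagonalizable_of_isIrreducible hV.irreducible) f hf]
  exact formalCharacter_eq_of_bijective (isDiagonalizable_of_isIrreducible hW.irreducible) g hg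

end HighestWeight

/-! ### Newton's identity for complete homogeneous sums -/

section Newton

variable {R : Type*} [CommRing R] {ι : Type*} [Fintype ι]

/-- The exponents of the monomials of degree `k` in variables indexed by `ι`. -/
def degreeEq (ι : Type*) [Fintype ι] (k : ℕ) : Finset (ι →₀ ℕ) :=
  (Finsupp.finite_of_degree_eq (σ := ι) k).toFinset

theorem mem_degreeEq {k : ℕ} {s : ι →₀ ℕ} : s ∈ degreeEq ι k ↔ s.degree = k := by
  simp [degreeEq]

/-- The complete homogeneous symmetric polynomial of degree `k`, evaluated at `x`. -/
def completeSum (x : ι → R) (k : ℕ) : R :=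
  ∑ s ∈ degreeEq ι k, s.prod fun j n => x j ^ n

theorem completeSum_zero (x : ι → R) : completeSum x 0 = 1 := by
  have : degreeEq ι 0 = {0} := by
    ext s
    rw [mem_degreeEq, Finsupp.degree_eq_zero_iff, Finset.mem_singleton]
  rw [completeSum, this, Finset.sum_singleton, Finsupp.prod_zero_index]

/-- Newton's identity relating power sums and complete homogeneous sums: for each `j`, writing a
monomial as `x_j ^ (i + 1)` times another one is possible in as many ways as its degree in `x_j`. -/
theorem nsmul_completeSum (x : ι → R) (k : ℕ) :
    k • completeSum x k
      = ∑ i ∈ Finset.range k, (∑ j, x j ^ (i + 1)) * completeSum x (k - 1 - i) := by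
  classical
  have hprod (t : ι →₀ ℕ) (j : ι) (n : ℕ) : ((t + Finsupp.single j n).prod fun j n => x j ^ n)
      = x j ^ n * t.prod fun j n => x j ^ n := by
    rw [Finsupp.prod_add_index' (by simp) (by simp [pow_add]), Finsupp.prod_single_index (by simp),
      mul_comm]
  have hj (j : ι) : ∑ s ∈ degreeEq ι k, ∑ i ∈ Finset.range (s j), (s.prod fun j n => x j ^ n)
      = ∑ i ∈ Finset.range k, ∑ t ∈ degreeEq ι (k - 1 - i),
        x j ^ (i + 1) * t.prod fun j n => x j ^ n := by
    rw [Finset.sum_sigma', Finset.sum_sigma']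
    refine Finset.sum_bij' (fun p _ => ⟨p.2, p.1 - Finsupp.single j (p.2 + 1)⟩)
      (fun p _ => ⟨p.2 + Finsupp.single j (p.1 + 1), p.1⟩) ?_ ?_ ?_ ?_ ?_
    · rintro ⟨s, i⟩ h
      simp only [Finset.mem_sigma, mem_degreeEq, Finset.mem_range] at h ⊢
      have hle : Finsupp.single j (i + 1) ≤ s := Finsupp.single_le_iff.2 h.2
      have hdeg := congrArg Finsupp.degree (tsub_add_cancel_of_le hle)
      rw [map_add, Finsupp.degree_single, h.1] at hdeg
      omega
    · rintro ⟨i, t⟩ h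
      simp only [Finset.mem_sigma, mem_degreeEq, Finset.mem_range, map_add, Finsupp.degree_single,
        Finsupp.add_apply, Finsupp.single_eq_same] at h ⊢
      omega
    · rintro ⟨s, i⟩ h
      simp only [Finset.mem_sigma, mem_degreeEq, Finset.mem_range] at h
      have hle : Finsupp.single j (i + 1) ≤ s := Finsupp.single_le_iff.2 h.2
      simp only [tsub_add_cancel_of_le hle]
    · rintro ⟨i, t⟩ _
      simp only [add_tsub_cancel_right]
    · rintro ⟨s, i⟩ h
      simp only [Finset.mem_sigma, mem_degreeEq, Finset.mem_range] at h
      have hle : Finsupp.single j (i + 1) ≤ s := Finsupp.single_le_iff.2 h.2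
      simp only
      rw [← hprod, tsub_add_cancel_of_le hle]
  calc k • completeSum x k
      = ∑ s ∈ degreeEq ι k, ∑ j, ∑ i ∈ Finset.range (s j), (s.prod fun j n => x j ^ n) := by
        rw [completeSum, Finset.smul_sum]
        refine Finset.sum_congr rfl fun s hs => ?_
        simp only [Finset.sum_const, Finset.card_range]
        rw [← Finset.sum_smul, ← Finsupp.degree_eq_sum, mem_degreeEq.1 hs]
    _ = _ := by
        rw [Finset.sum_comm, Finset.sum_congr rfl fun j _ => hj j, Finset.sum_comm]
        simp only [completeSum, Finset.sum_mul_sum]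

/-- Power sums lie in every additive subgroup that is closed under multiplication and contains the
complete homogeneous sums of positive degree. -/
theorem sum_pow_mem_of_completeSum_mem (A : AddSubgroup R) (hA : ∀ r ∈ A, ∀ s ∈ A, r * s ∈ A)
    (x : ι → R) (hx : ∀ k, 0 < k → completeSum x k ∈ A) (k : ℕ) (hk : 0 < k) :
    ∑ j, x j ^ k ∈ A := by
  induction k using Nat.strong_induction_on with
  | _ k ih =>
    obtain ⟨k, rfl⟩ := Nat.exists_eq_succ_of_ne_zero hk.ne'
    have h := nsmul_completeSum x (k + 1)
    rw [Finset.sum_range_succ, Nat.add_sub_cancel, Nat.sub_self, completeSum_zero, mul_one] at h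
    rw [Nat.succ_eq_add_one, ← sub_eq_of_eq_add' h]
    refine A.sub_mem (A.nsmul_mem (hx _ hk) _) (A.sum_mem fun i hi => ?_)
    rw [Finset.mem_range] at hi
    exact hA _ (ih (i + 1) (by omega) (by omega)) _ (hx _ (by omega))

end Newton

/-! ### Symmetric powers -/

section SymmetricPower

open MvPolynomial

variable {V : Type*} [AddCommGroup V] [Module ℂ V] [LieRingModule L V] [LieModule ℂ L V]
  {ι : Type v} (B : Basis ι ℂ V)

/-- The embedding of `V` into polynomials as linear forms, identifying basis vectors and
variables. -/
def toLinearForm : V →ₗ[ℂ] MvPolynomial ι ℂ := B.constr ℂ X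

theorem toLinearForm_basis (i : ι) : toLinearForm B (B i) = X i := B.constr_basis ℂ _ i

theorem isHomogeneous_toLinearForm (v : V) : (toLinearForm B v).IsHomogeneous 1 := by
  rw [toLinearForm, B.constr_apply]
  exact IsHomogeneous.sum _ _ _ fun i _ =>
    (homogeneousSubmodule ι ℂ 1).smul_mem _ (isHomogeneous_X ℂ i)

/-- The derivation of the polynomial ring extending the action of `x` on the linear forms. -/
def symDerivation (x : L) : Derivation ℂ (MvPolynomial ι ℂ) (MvPolynomial ι ℂ) :=
  mkDerivation ℂ fun i => toLinearForm B ⁅x, B i⁆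

theorem symDerivation_X (x : L) (i : ι) : symDerivation B x (X i) = toLinearForm B ⁅x, B i⁆ :=
  mkDerivation_X _ _ _

theorem symDerivation_toLinearForm (x : L) (v : V) :
    symDerivation B x (toLinearForm B v) = toLinearForm B ⁅x, v⁆ := by
  have : (symDerivation B x : MvPolynomial ι ℂ →ₗ[ℂ] MvPolynomial ι ℂ) ∘ₗ toLinearForm B
      = toLinearForm B ∘ₗ LieModule.toEnd ℂ L V x := B.ext fun i => by
    change symDerivation B x (toLinearForm B (B i)) = toLinearForm B ⁅x, B i⁆
    rw [toLinearForm_basis, symDerivation_X]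
  exact LinearMap.congr_fun this v

theorem symDerivation_add (x y : L) :
    symDerivation B (x + y) = symDerivation B x + symDerivation B y :=
  derivation_ext fun i => by
    rw [Derivation.add_apply, symDerivation_X, symDerivation_X, symDerivation_X, add_lie, map_add]

theorem symDerivation_smul (c : ℂ) (x : L) : symDerivation B (c • x) = c • symDerivation B x :=
  derivation_ext fun i => by
    rw [Derivation.smul_apply, symDerivation_X, symDerivation_X, smul_lie, map_smul]

theorem symDerivation_lie (x y : L) :
    symDerivation B ⁅x, y⁆ = ⁅symDerivation B x, symDerivation B y⁆ :=
  derivation_ext fun i => by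
    rw [Derivation.commutator_apply, symDerivation_X, symDerivation_X, symDerivation_X,
      symDerivation_toLinearForm, symDerivation_toLinearForm, lie_lie, map_sub]

theorem degree_eq_of_mem_support {k : ℕ} {p : MvPolynomial ι ℂ}
    (hp : p ∈ homogeneousSubmodule ι ℂ k) {s : ι →₀ ℕ} (hs : s ∈ p.support) : s.degree = k := by
  rw [Finsupp.degree_eq_weight_one]
  exact hp (mem_support_iff.1 hs)

theorem symDerivation_mem (x : L) (k : ℕ) {p : MvPolynomial ι ℂ}
    (hp : p ∈ homogeneousSubmodule ι ℂ k) : symDerivation B x p ∈ homogeneousSubmodule ι ℂ k := by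
  rw [← support_sum_monomial_coeff p, map_sum]
  refine Submodule.sum_mem _ fun s hs => ?_
  rw [symDerivation, mkDerivation_monomial]
  refine Submodule.smul_mem _ _ (Submodule.sum_mem _ fun i hi => ?_)
  have hle : Finsupp.single i 1 ≤ s :=
    Finsupp.single_le_iff.2 (Nat.one_le_iff_ne_zero.2 (Finsupp.mem_support_iff.1 hi))
  have hdeg : (s - Finsupp.single i 1).degree + 1 = k := by
    have h := congrArg Finsupp.degree (tsub_add_cancel_of_le hle)
    rwa [map_add, Finsupp.degree_single, degree_eq_of_mem_support hp hs] at h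
  have h := (isHomogeneous_monomial ((s i : ℕ) : ℂ) (rfl : _ = (s - Finsupp.single i 1).degree)).mul
    (isHomogeneous_toLinearForm B ⁅x, B i⁆)
  rw [hdeg] at h
  exact h

/-- The `k`-th symmetric power of `V`, as the space of homogeneous polynomials of degree `k` in the
members of a basis, which determines the action of `L`. -/
def SymPower (_ : Basis ι ℂ V) (k : ℕ) : Type v := homogeneousSubmodule ι ℂ k

instance (k : ℕ) : AddCommGroup (SymPower B k) :=
  inferInstanceAs (AddCommGroup (homogeneousSubmodule ι ℂ k))

instance (k : ℕ) : Module ℂ (SymPower B k) :=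
  inferInstanceAs (Module ℂ (homogeneousSubmodule ι ℂ k))

instance [Fintype ι] (k : ℕ) : FiniteDimensional ℂ (SymPower B k) :=
  Module.Finite.iff_fg.2 (homogeneousSubmodule_fg ι ℂ k)

instance (k : ℕ) : LieRingModule L (SymPower B k) where
  bracket x p := ⟨symDerivation B x p.1, symDerivation_mem B x k p.2⟩
  add_lie x y p := Subtype.ext (by
    change symDerivation B (x + y) p.1 = symDerivation B x p.1 + symDerivation B y p.1
    rw [symDerivation_add, Derivation.add_apply])
  lie_add x p q := Subtype.ext (map_add (symDerivation B x) p.1 q.1)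
  leibniz_lie x y p := Subtype.ext (by
    change symDerivation B x (symDerivation B y p.1)
      = symDerivation B ⁅x, y⁆ p.1 + symDerivation B y (symDerivation B x p.1)
    rw [symDerivation_lie, Derivation.commutator_apply, sub_add_cancel])

instance (k : ℕ) : LieModule ℂ L (SymPower B k) where
  smul_lie c x p := Subtype.ext (by
    change symDerivation B (c • x) p.1 = c • symDerivation B x p.1
    rw [symDerivation_smul, Derivation.smul_apply])
  lie_smul c x p := Subtype.ext ((symDerivation B x).map_smul c p.1)

theorem symDerivation_monomial {ν : ι → Dual ℂ H} (hB : ∀ i, HasWeight (ν i) (B i)) (h : H)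
    (s : ι →₀ ℕ) : symDerivation B (h : L) (monomial s 1)
      = (s.sum fun i n => n • ν i) h • monomial s (1 : ℂ) := by
  rw [symDerivation, mkDerivation_monomial, one_smul, Finsupp.sum, Finsupp.sum, LinearMap.sum_apply,
    Finset.sum_smul]
  refine Finset.sum_congr rfl fun i hi => ?_
  have hle : Finsupp.single i 1 ≤ s :=
    Finsupp.single_le_iff.2 (Nat.one_le_iff_ne_zero.2 (Finsupp.mem_support_iff.1 hi))
  rw [hB i h, map_smul, toLinearForm_basis, smul_comm, X, smul_eq_mul, monomial_mul,
    tsub_add_cancel_of_le hle, LinearMap.smul_apply, smul_monomial, smul_monomial]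
  simp [mul_comm]

/-- The formal character of a symmetric power is a complete homogeneous sum of exponentials of
weights. -/
theorem formalCharacter_symPower [Fintype ι] (ν : ι → Dual ℂ H)
    (hB : ∀ i, HasWeight (ν i) (B i)) (k : ℕ) :
    IsDiagonalizable H (SymPower B k) ∧ formalCharacter H (SymPower B k)
      = completeSum (fun i => AddMonoidAlgebra.single (ν i) (1 : ℤ)) k := by
  let m (s : degreeEq ι k) : homogeneousSubmodule ι ℂ k :=
    ⟨monomial s.1 1, isHomogeneous_monomial 1 (mem_degreeEq.1 s.2)⟩
  have hm : LinearIndependent ℂ m := by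
    refine LinearIndependent.of_comp (homogeneousSubmodule ι ℂ k).subtype ?_
    have := (basisMonomials ι ℂ).linearIndependent.comp _
      (Subtype.val_injective (p := (· ∈ degreeEq ι k)))
    rw [coe_basisMonomials] at this
    exact this
  have hspan : ⊤ ≤ Submodule.span ℂ (Set.range m) := by
    rintro ⟨p, hp⟩ -
    have hp' : (⟨p, hp⟩ : homogeneousSubmodule ι ℂ k) = ∑ s ∈ p.support.attach,
        p.coeff s.1 • m ⟨s.1, mem_degreeEq.2 (degree_eq_of_mem_support hp s.2)⟩ := by
      refine Subtype.ext ?_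
      rw [AddSubmonoidClass.coe_finsetSum]
      simp only [m, Submodule.coe_smul, smul_monomial, smul_eq_mul, mul_one]
      rw [Finset.sum_attach p.support (fun s => monomial s (p.coeff s)), support_sum_monomial_coeff]
    rw [hp']
    exact Submodule.sum_mem _ fun s _ => Submodule.smul_mem _ _ (Submodule.subset_span ⟨_, rfl⟩)
  let C : Basis (degreeEq ι k) ℂ (SymPower B k) := Basis.mk hm hspan
  have hC (s : degreeEq ι k) : HasWeight (s.1.sum fun i n => n • ν i) (C s) := by
    intro h
    have hCs : C s = m s := Basis.mk_apply hm hspan s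
    rw [hCs]
    exact Subtype.ext (symDerivation_monomial B hB h s.1)
  refine ⟨isDiagonalizable_of_basis C _ hC, ?_⟩
  rw [formalCharacter_eq_sum C _ hC, completeSum]
  refine (Finset.sum_coe_sort (degreeEq ι k)
    (fun s => AddMonoidAlgebra.single (s.sum fun i n => n • ν i) (1 : ℤ))).trans
    (Finset.sum_congr rfl fun s _ => ?_)
  simp only [Finsupp.prod, Finsupp.sum, AddMonoidAlgebra.single_pow, one_pow,
    AddMonoidAlgebra.prod_single, Finset.prod_const_one]

end SymmetricPower

/-! ### The span of the irreducible characters -/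

section Characters

variable (b : (rootSystem H).Base)

variable (H) in
/-- `χ` is the formal character of a finite-dimensional diagonalizable module. -/
def IsModuleCharacter (χ : ℤ[Dual ℂ H]) : Prop :=
  ∃ (M : Type v) (_ : AddCommGroup M) (_ : Module ℂ M) (_ : LieRingModule L M)
    (_ : LieModule ℂ L M) (_ : FiniteDimensional ℂ M),
    IsDiagonalizable H M ∧ χ = formalCharacter H M

theorem IsModuleCharacter.mul {χ ψ : ℤ[Dual ℂ H]} (hχ : IsModuleCharacter.{u, v} H χ)
    (hψ : IsModuleCharacter.{u, v} H ψ) : IsModuleCharacter.{u, v} H (χ * ψ) := by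
  obtain ⟨M, _, _, _, _, _, hM, rfl⟩ := hχ
  obtain ⟨N, _, _, _, _, _, hN, rfl⟩ := hψ
  obtain ⟨h1, h2⟩ := formalCharacter_tensorProduct hM hN
  exact ⟨_, _, _, _, _, inferInstance, h1, h2.symm⟩

theorem isIrreducible_of_isAtom {M : Type*} [AddCommGroup M] [Module ℂ M] [LieRingModule L M]
    [LieModule ℂ L M] {N : LieSubmodule ℂ L M} (hN : IsAtom N) : LieModule.IsIrreducible ℂ L N := by
  have : Nontrivial N := (LieSubmodule.nontrivial_iff_ne_bot ℂ L M).2 hN.1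
  refine .mk fun K hK => ?_
  have hle : K.map N.incl ≤ N := by
    rw [LieSubmodule.map_le_iff_le_comap]
    intro x _
    exact x.2
  rcases hN.le_iff.1 hle with h | h
  · refine absurd ?_ hK
    rw [LieSubmodule.eq_bot_iff]
    intro x hx
    have : (x : M) ∈ K.map N.incl := LieSubmodule.mem_map_of_mem (f := N.incl) hx
    rw [h, LieSubmodule.mem_bot] at this
    exact Subtype.ext this
  · rw [eq_top_iff]
    intro x _
    have : (x : M) ∈ K.map N.incl := by
      rw [h]
      exact x.2
    obtain ⟨y, hy, hyx⟩ := (LieSubmodule.mem_map _).1 this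
    rwa [← (Subtype.ext hyx : y = x)]

/-- The character of a diagonalizable module is the sum of the characters of its composition
factors. -/
theorem formalCharacter_mem_closure (M : Type v) [AddCommGroup M] [Module ℂ M] [LieRingModule L M]
    [LieModule ℂ L M] [FiniteDimensional ℂ M] (hM : IsDiagonalizable H M) :
    formalCharacter H M
      ∈ AddSubgroup.closure {χ | ∃ μ, IsIrredCharacter.{u, v} b μ χ} := by
  induction hn : finrank ℂ M using Nat.strong_induction_on generalizing M with
  | _ n ih =>
    rcases eq_bot_or_exists_atom_le (⊤ : LieSubmodule ℂ L M) with h | ⟨N, hN, -⟩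
    · have : Subsingleton M :=
        (LieSubmodule.subsingleton_iff ℂ L M).1 (subsingleton_of_bot_eq_top h.symm)
      have h0 : formalCharacter H M = 0 := by
        obtain ⟨ι, _, B, ν, hB⟩ := hM.exists_basis
        have : IsEmpty ι := ⟨fun i => B.ne_zero i (Subsingleton.elim _ _)⟩
        rw [formalCharacter_eq_sum B ν hB, Finset.univ_eq_empty, Finset.sum_empty]
      rw [h0]
      exact zero_mem _
    · have hirr := isIrreducible_of_isAtom hN
      obtain ⟨hQ, hadd⟩ :=
        formalCharacter_eq_add_quotient hM N (isDiagonalizable_of_isIrreducible hirr)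
      obtain ⟨μ, hμ⟩ := exists_isIrredOfHighestWeight b hirr
      have hlt : finrank ℂ (M ⧸ N) < n := by
        have h1 := N.toSubmodule.finrank_quotient_add_finrank
        have h2 : 0 < finrank ℂ N.toSubmodule := by
          have : Nontrivial N.toSubmodule := (LieSubmodule.nontrivial_iff_ne_bot ℂ L M).2 hN.1
          exact finrank_pos
        have h3 : finrank ℂ (M ⧸ N) = finrank ℂ (M ⧸ N.toSubmodule) := rfl
        omega
      rw [hadd]
      exact add_mem (AddSubgroup.subset_closure ⟨μ, N, _, _, _, _, inferInstance, hμ, rfl⟩)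
        (ih _ hlt (M ⧸ N) hQ rfl)

/-- Adams operations preserve the span of the irreducible characters: in terms of a basis of weight
vectors, `ψ_a(ch_V)` is a power sum, hence by Newton's identity an integer polynomial in the
characters of the symmetric powers of `V`. -/
theorem adams_formalCharacter_mem_closure {a : ℕ} (ha : 0 < a) (V : Type v) [AddCommGroup V]
    [Module ℂ V] [LieRingModule L V] [LieModule ℂ L V] [FiniteDimensional ℂ V]
    (hV : IsDiagonalizable H V) :
    adams a (formalCharacter H V)
      ∈ AddSubgroup.closure {χ | ∃ μ, IsIrredCharacter.{u, v} b μ χ} := by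
  obtain ⟨ι, _, B, ν, hB⟩ := hV.exists_basis
  let A := AddSubgroup.closure {χ | IsModuleCharacter.{u, v} H χ}
  have hmul (r) (hr : r ∈ A) (s) (hs : s ∈ A) : r * s ∈ A := by
    induction hr, hs using AddSubgroup.closure_induction₂ with
    | mem x y hx hy => exact AddSubgroup.subset_closure (hx.mul hy)
    | zero_left => rw [zero_mul]; exact A.zero_mem
    | zero_right => rw [mul_zero]; exact A.zero_mem
    | add_left x y z _ _ _ h1 h2 => rw [add_mul]; exact A.add_mem h1 h2
    | add_right x y z _ _ _ h1 h2 => rw [mul_add]; exact A.add_mem h1 h2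
    | neg_left x y _ _ h => rw [neg_mul]; exact A.neg_mem h
    | neg_right x y _ _ h => rw [mul_neg]; exact A.neg_mem h
  have hle : A ≤ AddSubgroup.closure {χ | ∃ μ, IsIrredCharacter.{u, v} b μ χ} := by
    rw [AddSubgroup.closure_le]
    rintro _ ⟨M, _, _, _, _, _, hM, rfl⟩
    exact formalCharacter_mem_closure b M hM
  have hadams : adams a (formalCharacter H V)
      = ∑ i, AddMonoidAlgebra.single (ν i) (1 : ℤ) ^ a := by
    rw [formalCharacter_eq_sum B ν hB, map_sum]
    refine Finset.sum_congr rfl fun i _ => ?_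
    rw [AddMonoidAlgebra.single_pow, one_pow]
    exact AddMonoidAlgebra.mapDomain_single
  rw [hadams]
  refine hle (sum_pow_mem_of_completeSum_mem A hmul _ (fun k _ => ?_) a ha)
  obtain ⟨h1, h2⟩ := formalCharacter_symPower B ν hB k
  exact AddSubgroup.subset_closure ⟨SymPower B k, _, _, _, _, inferInstance, h1, h2.symm⟩

/-! ### Plethysm multiplicities -/

variable {b}

theorem IsIrredCharacter.unique {μ : Dual ℂ H} {χ ψ : ℤ[Dual ℂ H]}
    (hχ : IsIrredCharacter.{u, v} b μ χ) (hψ : IsIrredCharacter.{u, v} b μ ψ) : χ = ψ := by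
  obtain ⟨M, _, _, _, _, _, hM, rfl⟩ := hχ
  obtain ⟨N, _, _, _, _, _, hN, rfl⟩ := hψ
  exact hM.formalCharacter_eq hN

theorem IsIrredCharacter.mem_dominantWeights {μ : Dual ℂ H} {χ : ℤ[Dual ℂ H]}
    (hχ : IsIrredCharacter.{u, v} b μ χ) : μ ∈ dominantWeights b := by
  obtain ⟨M, _, _, _, _, _, hM, rfl⟩ := hχ
  exact hM.mem_dominantWeights

theorem IsIrredCharacter.coeff_self {μ : Dual ℂ H} {χ : ℤ[Dual ℂ H]}
    (hχ : IsIrredCharacter.{u, v} b μ χ) : χ.coeff μ = 1 := by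
  obtain ⟨M, _, _, _, _, _, hM, rfl⟩ := hχ
  exact hM.coeff_formalCharacter_self

theorem IsIrredCharacter.weightInner_lt {μ ν : Dual ℂ H} {χ : ℤ[Dual ℂ H]}
    (hχ : IsIrredCharacter.{u, v} b μ χ) (hν : χ.coeff ν ≠ 0) (hne : μ ≠ ν) :
    weightInner 1 ν (rho b) < weightInner 1 μ (rho b) := by
  obtain ⟨M, _, _, _, _, _, hM, rfl⟩ := hχ
  obtain ⟨d, hd, rfl⟩ := hM.exists_eq_add hν
  have h := weightInner_rho_pos one_pos hd (by simpa using hne)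
  rw [weightInner_add_left]
  linarith

variable (b) in
open Classical in
/-- The character of the irreducible module of highest weight `μ`, or zero if there is no such
finite-dimensional module. -/
def irredCharacter (μ : Dual ℂ H) : ℤ[Dual ℂ H] :=
  if h : ∃ χ, IsIrredCharacter.{u, v} b μ χ then h.choose else 0

theorem IsIrredCharacter.eq {μ : Dual ℂ H} {χ : ℤ[Dual ℂ H]}
    (hχ : IsIrredCharacter.{u, v} b μ χ) : irredCharacter.{u, v} b μ = χ := by
  have h : ∃ χ, IsIrredCharacter.{u, v} b μ χ := ⟨χ, hχ⟩
  rw [irredCharacter, dif_pos h]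
  exact h.choose_spec.unique hχ

/-- In a combination of irreducible characters, the coefficient at `μ` is the multiplicity of the
irreducible character with highest weight `μ`, if no `ν` with larger `(ν, ρ)` occurs. -/
theorem coeff_sum_irredCharacter {m : Dual ℂ H →₀ ℤ}
    (hm : ∀ ν ∈ m.support, IsIrredCharacter.{u, v} b ν (irredCharacter.{u, v} b ν)) {μ : Dual ℂ H}
    (hmax : ∀ ν ∈ m.support, weightInner 1 ν (rho b) ≤ weightInner 1 μ (rho b)) :
    (m.sum fun ν k => k • irredCharacter.{u, v} b ν).coeff μ = m μ := by
  rw [AddMonoidAlgebra.coeff_finsuppSum, Finsupp.sum, Finsupp.finsetSum_apply,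
    Finset.sum_eq_single μ]
  · by_cases hμ : μ ∈ m.support
    · rw [AddMonoidAlgebra.coeff_smul_apply, (hm μ hμ).coeff_self, smul_eq_mul, mul_one]
    · rw [Finsupp.notMem_support_iff.1 hμ]
      simp
  · intro ν hν hne
    rw [AddMonoidAlgebra.coeff_smul_apply, smul_eq_zero]
    right
    by_contra h0
    exact ((hm ν hν).weightInner_lt h0 hne).not_ge (hmax ν hν)
  · intro hμ
    rw [Finsupp.notMem_support_iff.1 hμ]
    simp

theorem exists_max_weight {m : Dual ℂ H →₀ ℤ} (hm : m ≠ 0) : ∃ μ ∈ m.support,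
    ∀ ν ∈ m.support, weightInner 1 ν (rho b) ≤ weightInner 1 μ (rho b) :=
  m.support.exists_max_image _ (Finsupp.support_nonempty_iff.2 hm)

theorem IsPlethysmMultiplicity.isIrredCharacter {a : ℕ} {χ : ℤ[Dual ℂ H]} {m : Dual ℂ H →₀ ℤ}
    (h : IsPlethysmMultiplicity.{u, v} b a χ m) :
    (∀ ν ∈ m.support, IsIrredCharacter.{u, v} b ν (irredCharacter.{u, v} b ν)) ∧
      adams a χ = m.sum fun ν k => k • irredCharacter.{u, v} b ν := by
  obtain ⟨-, ch, hch, hsum⟩ := h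
  refine ⟨fun ν hν => (hch ν hν).eq ▸ hch ν hν, hsum.trans (Finset.sum_congr rfl fun ν hν => ?_)⟩
  simp only [(hch ν hν).eq]

theorem IsPlethysmMultiplicity.unique {a : ℕ} {χ : ℤ[Dual ℂ H]} {m m' : Dual ℂ H →₀ ℤ}
    (h : IsPlethysmMultiplicity.{u, v} b a χ m) (h' : IsPlethysmMultiplicity.{u, v} b a χ m') :
    m' = m := by
  classical
  obtain ⟨h1, h2⟩ := h.isIrredCharacter
  obtain ⟨h1', h2'⟩ := h'.isIrredCharacter
  have hsub : ∀ ν ∈ (m' - m).support, IsIrredCharacter.{u, v} b ν (irredCharacter.{u, v} b ν) := by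
    intro ν hν
    rcases Finset.mem_union.1 (Finsupp.support_sub hν) with hν | hν
    · exact h1' ν hν
    · exact h1 ν hν
  rw [← sub_eq_zero]
  by_contra hne
  obtain ⟨μ, hμ, hmax⟩ := exists_max_weight (b := b) hne
  refine Finsupp.mem_support_iff.1 hμ ?_
  rw [← coeff_sum_irredCharacter hsub hmax, Finsupp.sum_sub_index fun _ _ _ => sub_smul _ _ _,
    ← h2, ← h2', sub_self]
  rfl

theorem exists_isPlethysmMultiplicity {a : ℕ} {χ : ℤ[Dual ℂ H]}
    (h : adams a χ ∈ AddSubgroup.closure {χ | ∃ μ, IsIrredCharacter.{u, v} b μ χ}) :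
    ∃ m, IsPlethysmMultiplicity.{u, v} b a χ m := by
  classical
  suffices ∃ m : Dual ℂ H →₀ ℤ,
      (∀ ν ∈ m.support, IsIrredCharacter.{u, v} b ν (irredCharacter.{u, v} b ν)) ∧
        adams a χ = m.sum fun ν k => k • irredCharacter.{u, v} b ν by
    obtain ⟨m, h1, h2⟩ := this
    exact ⟨m, fun ν hν => (h1 ν hν).mem_dominantWeights, _, h1, h2⟩
  generalize adams a χ = ψ at h ⊢
  induction h using AddSubgroup.closure_induction with
  | mem x hx =>
    obtain ⟨μ, hμ⟩ := hx
    refine ⟨Finsupp.single μ 1, fun ν hν => ?_, ?_⟩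
    · obtain rfl := Finset.mem_singleton.1 (Finsupp.support_single_subset hν)
      exact hμ.eq ▸ hμ
    · rw [Finsupp.sum_single_index (h := fun ν k => k • irredCharacter.{u, v} b ν)
        (zero_smul ℤ _), one_smul, hμ.eq]
  | zero => exact ⟨0, by simp, by simp⟩
  | add x y _ _ hx hy =>
    obtain ⟨m, h1, h2⟩ := hx
    obtain ⟨m', h1', h2'⟩ := hy
    refine ⟨m + m', fun ν hν => ?_, ?_⟩
    · rcases Finset.mem_union.1 (Finsupp.support_add hν) with hν | hν
      · exact h1 ν hν
      · exact h1' ν hν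
    · rw [Finsupp.sum_add_index' (h := fun ν k => k • irredCharacter.{u, v} b ν)
        (fun _ => zero_smul ℤ _) (fun _ _ _ => add_smul _ _ _), h2, h2']
  | neg x _ hx =>
    obtain ⟨m, h1, h2⟩ := hx
    refine ⟨-m, fun ν hν => h1 ν (by rwa [Finsupp.support_neg] at hν), ?_⟩
    rw [Finsupp.sum_neg_index (h := fun ν k => k • irredCharacter.{u, v} b ν)
      fun _ => zero_smul ℤ _, h2, Finsupp.sum, Finsupp.sum,
      ← Finset.sum_neg_distrib]
    simp only [neg_smul]

theorem coeff_adams_nsmul {a : ℕ} (ha : 0 < a) (χ : ℤ[Dual ℂ H]) (ν : Dual ℂ H) :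
    (adams a χ).coeff (a • ν) = χ.coeff ν := by
  have : IsAddTorsionFree (Dual ℂ H) := .of_isTorsionFree ℂ _
  exact Finsupp.mapDomain_apply (nsmul_right_injective ha.ne') χ.coeff ν

theorem exists_eq_nsmul_of_coeff_adams_ne_zero {a : ℕ} {χ : ℤ[Dual ℂ H]} {ν : Dual ℂ H}
    (h : (adams a χ).coeff ν ≠ 0) : ∃ ν', χ.coeff ν' ≠ 0 ∧ ν = a • ν' := by
  classical
  have := Finsupp.mapDomain_support (Finsupp.mem_support_iff.2 h)
  obtain ⟨ν', h1, h2⟩ := Finset.mem_image.1 this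
  exact ⟨ν', Finsupp.mem_support_iff.1 h1, h2.symm⟩

/-- The multiplicity of `V_{aλ}` in `ψ_a(ch_λ)` is one: both `ψ_a(ch_λ)` and any combination of
irreducible characters have their highest terms with equal coefficients, and that of `ψ_a(ch_λ)` is
the `a`-fold multiple of the highest weight `λ`, which has multiplicity one. -/
theorem IsPlethysmMultiplicity.apply_nsmul_eq_one {a : ℕ} (ha : 0 < a) {lam : Dual ℂ H}
    {V : Type v} [AddCommGroup V] [Module ℂ V] [LieRingModule L V] [LieModule ℂ L V]
    [FiniteDimensional ℂ V] (hV : IsIrredOfHighestWeight V b lam) {m : Dual ℂ H →₀ ℤ}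
    (h : IsPlethysmMultiplicity.{u, v} b a (formalCharacter H V) m) : m (a • lam) = 1 := by
  obtain ⟨h1, h2⟩ := h.isIrredCharacter
  have hone : (m.sum fun ν k => k • irredCharacter.{u, v} b ν).coeff (a • lam) = 1 := by
    rw [← h2, coeff_adams_nsmul ha, hV.coeff_formalCharacter_self]
  rw [← hone, coeff_sum_irredCharacter h1]
  have hm : m ≠ 0 := by
    rintro rfl
    simp at hone
  obtain ⟨μ, hμ, hmax⟩ := exists_max_weight (b := b) hm
  have hcoeff : (adams a (formalCharacter H V)).coeff μ ≠ 0 := by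
    rw [h2, coeff_sum_irredCharacter h1 hmax]
    exact Finsupp.mem_support_iff.1 hμ
  obtain ⟨χ, hχ, rfl⟩ := exists_eq_nsmul_of_coeff_adams_ne_zero hcoeff
  obtain ⟨d, hd, rfl⟩ := hV.exists_eq_add hχ
  intro ν hν
  refine (hmax ν hν).trans ?_
  rw [nsmul_add, weightInner_add_left, le_add_iff_nonneg_right]
  exact weightInner_nonneg one_pos (nsmul_mem hd a) fun i hi => by
    rw [rho_apply_coroot hi, Complex.one_re]
    exact zero_le_one

end Characters

/-! ### The summation set -/

section SummationSet

variable {b : (rootSystem H).Base} {lam : Dual ℂ H} {V : Type v} [AddCommGroup V] [Module ℂ V]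
  [LieRingModule L V] [LieModule ℂ L V] [FiniteDimensional ℂ V]

theorem nsmul_mem_dominantWeights {μ : Dual ℂ H} (hμ : μ ∈ dominantWeights b) (a : ℕ) :
    a • μ ∈ dominantWeights b := by
  intro i hi
  obtain ⟨n, hn⟩ := hμ i hi
  exact ⟨a * n, by rw [LinearMap.smul_apply, hn]; simp⟩

theorem nsmul_mem_summationSet (hV : IsIrredOfHighestWeight V b lam) (a : ℕ) :
    a • lam ∈ summationSet V b a := by
  refine ⟨Set.mem_iUnion.2 ⟨1, lam, ?_, by simp⟩,
    nsmul_mem_dominantWeights hV.mem_dominantWeights a⟩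
  obtain ⟨v, h0, hv⟩ := hV.exists_isHighestWeightVector
  exact mem_weights_iff.2 ⟨v, h0, hv.hasWeight⟩

/-- All elements of the summation set lie below `aλ`, since `σρ ≤ ρ` and `ν ≤ λ` for all weights
`ν` of `V_λ`. As `ρ - σρ` is obtained as half a sum of positive roots, the statement is that
`2aλ - 2μ` lies in the cone. -/
theorem exists_two_smul_eq_of_mem_summationSet (hV : IsIrredOfHighestWeight V b lam) {a : ℕ}
    {μ : Dual ℂ H} (hμ : μ ∈ summationSet V b a) :
    ∃ d ∈ rootCone b, (2 : ℕ) • (a • lam) = (2 : ℕ) • μ + d := by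
  obtain ⟨σ, ν, hν, rfl⟩ := Set.mem_iUnion.1 hμ.1
  obtain ⟨d, hd, hρ⟩ := exists_two_smul_rho_eq (b := b) σ
  obtain ⟨e, he, rfl⟩ := hV.exists_eq_add (coeff_formalCharacter_ne_zero_iff.2 hν)
  refine ⟨d + 2 • (a • e), add_mem hd (nsmul_mem (nsmul_mem he a) 2), ?_⟩
  simp only [nsmul_add, nsmul_sub, hρ]
  abel

end SummationSet

end TorusPlethysm

end

theorem mainTheorem6 {L : Type u} [LieRing L] [LieAlgebra ℂ L] [FiniteDimensional ℂ L]
    [LieAlgebra.IsSimple ℂ L] (H : LieSubalgebra ℂ L) [H.IsCartanSubalgebra]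
    (base : (LieAlgebra.IsKilling.rootSystem H).Base) (c : ℝ) (hc : 0 < c)
    (a b : ℕ) (ha : 0 < a) (hab : a < b) (hcop : Nat.Coprime a b)
    (lam : Module.Dual ℂ H)
    (V : Type v) [AddCommGroup V] [Module ℂ V] [LieRingModule L V] [LieModule ℂ L V]
    [FiniteDimensional ℂ V] (hV : TorusPlethysm.IsIrredOfHighestWeight V base lam) :
    (a • lam ∈ TorusPlethysm.summationSet V base a ∧
      ∀ μ ∈ TorusPlethysm.summationSet V base a, μ ≠ a • lam →
        TorusPlethysm.maxDegree base c a b lam μ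
          < TorusPlethysm.maxDegree base c a b lam (a • lam)) ∧
    ∃ m : Module.Dual ℂ H →₀ ℤ,
      TorusPlethysm.IsPlethysmMultiplicity.{u, v} base a
        (TorusPlethysm.formalCharacter H V) m ∧
      (∀ m' : Module.Dual ℂ H →₀ ℤ,
        TorusPlethysm.IsPlethysmMultiplicity.{u, v} base a
          (TorusPlethysm.formalCharacter H V) m' → m' = m) ∧
      m (a • lam) = 1 := by
  have hdom := TorusPlethysm.nsmul_mem_summationSet hV a
  refine ⟨⟨hdom, fun μ hμ hne => ?_⟩, ?_⟩
  · obtain ⟨d, hd, h⟩ := TorusPlethysm.exists_two_smul_eq_of_mem_summationSet hV hμ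
    exact TorusPlethysm.maxDegree_lt_maxDegree hc ha b lam hμ.2 hdom.2 hd h hne
  · obtain ⟨m, hm⟩ := TorusPlethysm.exists_isPlethysmMultiplicity
      (TorusPlethysm.adams_formalCharacter_mem_closure base ha V
        (TorusPlethysm.isDiagonalizable_of_isIrreducible hV.irreducible))
    exact ⟨m, hm, fun m' hm' => hm.unique hm', hm.apply_nsmul_eq_one ha hV⟩
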